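/- **Corollary 2 (sample complexity).** There is a universal constant $C>0$ such that the following holds. *Setting.* Let $N\ge 1$ clients, dimension $d$, ranks $r_1\ge 1$ and $r_{2,(i)}\ge 1$, $\theta\in(0,1)$, $\delta>0$, $\epsilon>0$, $\sigma\ge 0$ be given. On client $i$ we observe i.i.d. random vectors $y_{(i),1},\dots,y_{(i),n_i}\in\mathbb{R}^d$ (the columns of $Y_{(i)}$) whose distribution has covariance matrix $\Sigma_{(i)}$ and is sub-Gaussian with parameter $\sigma$: $\mathbb{E}\,e^{\lambda\langle v,y_{(i),1}\rangle}\le e^{\lambda^2\sigma^2/2}$ for all unit vectors $v$ and all $\lambda\in\mathbb{R}$ (no independence between different clients is assumed). Put $S_{(i)}=\frac1{n_i}Y_{(i)}Y_{(i)}^T$, let $\lambda_1(A)\ge\lambda_2(A)\ge\cdots$ be the eigenvalues of a symmetric matrix $A$, and $P_U=UU^T$ for $U$ with $U^TU=I$. *Assumptions.* 1. (Orthogonality) $\Sigma_{(i)}=\Sigma_{(i),g}+\Sigma_{(i),l}$ with $\Sigma_{(i),g},\Sigma_{(i),l}$ positive semidefinite and $\Sigma_{(i),g}\Sigma_{(i),l}=0$.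 The matrix $\Pi_g$ (the same for all clients) is, for every $i$, the orthogonal projection onto the span of top $r_1$ eigenvectors of $\Sigma_{(i),g}$; $\Pi_{(i)}$ is the orthogonal projection onto the span of top $r_{2,(i)}$ eigenvectors of $\Sigma_{(i),l}$; and $\mathrm{col}(\Pi_g)\subseteq\mathrm{col}(\Sigma_{(i),g})$, $\mathrm{col}(\Pi_{(i)})\subseteq\mathrm{col}(\Sigma_{(i),l})$. 2. (Identifiability) $\lambda_{\max}\big(\frac1N\sum_{i=1}^N\Pi_{(i)}\big)\le 1-\theta$. 3. (Eigengap) For all $i$, $\min\{\lambda_{r_1}(\Sigma_{(i),g}),\lambda_{r_{2,(i)}}(\Sigma_{(i),l})\}-\max\{\lambda_{r_1+1}(\Sigma_{(i),g}),\lambda_{r_{2,(i)}+1}(\Sigma_{(i),l})\}\ge\delta$. *Estimator.* Let $\hat U\in\mathbb{R}^{d\times r_1}$ and $\hat V_{(i)}\in\mathbb{R}^{d\times r_{2,(i)}}$ denote any maximizer of $\frac12\sum_{i=1}^N\big[\mathrm{tr}(U^TS_{(i)}U)+\mathrm{tr}(V_{(i)}^TS_{(i)}V_{(i)})\big]$ subject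 to $U^TU=I$, $V_{(i)}^TV_{(i)}=I$, $V_{(i)}^TU=0$ for all $i$. *Conclusion.* Consider the inequality $$\|P_{\hat U}-\Pi_g\|_F^2+\frac1N\sum_{i=1}^N\|P_{\hat V_{(i)}}-\Pi_{(i)}\|_F^2<\epsilon .\qquad(*)$$ (a) For every $\eta\in(0,1)$: if $n_i\ge C\,\dfrac{\sigma^4 d\,(d+\log(2N/\eta))}{\epsilon\,\theta\,\delta^2}$ for all $i$, then with probability at least $1-\eta$, $(*)$ holds for every maximizer. (b) If $n_i\ge C\,\dfrac{\sigma^4d^2}{\epsilon\,\theta\,\delta^2}$ for all $i$, then with probability at least $1-2Ne^{-d}$, $(*)$ holds for every maximizer. -/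

import Mathlib

open MeasureTheory ProbabilityTheory
open scoped NNReal

namespace PerPCA

noncomputable section

/-- `eig A k` is the `k`-th largest eigenvalue `λ_k(A)` of the real symmetric matrix `A`, counted
with multiplicity and with `1 ≤ k ≤ d` (value `0` if `A` is not symmetric or `k` is out of range;
this never occurs where it is used). -/
def eig {d : ℕ} (A : Matrix (Fin d) (Fin d) ℝ) (k : ℕ) : ℝ :=
  open Classical in
  if h : A.IsHermitian ∧ 1 ≤ k ∧ k ≤ d then
    h.1.eigenvalues₀ ⟨k - 1, by rw [Fintype.card_fin]; omega⟩
  else 0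

/-- The squared Frobenius norm. -/
def frobSq {d : ℕ} (A : Matrix (Fin d) (Fin d) ℝ) : ℝ := ∑ a, ∑ b, A a b ^ 2

/-- `P_U = U Uᵀ`, the projection onto the column space of a matrix with orthonormal columns. -/
def proj {d r : ℕ} (U : Matrix (Fin d) (Fin r) ℝ) : Matrix (Fin d) (Fin d) ℝ :=
  U * U.transpose

/-- The column space of a square matrix. -/
def col {d : ℕ} (A : Matrix (Fin d) (Fin d) ℝ) : Submodule ℝ (Fin d → ℝ) :=
  LinearMap.range A.mulVecLin

/-- `P` is the projection onto the span of top `r` principal components of `A`, that is, of `r`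
orthonormal eigenvectors of `A` for its `r` largest eigenvalues `λ_1(A) ≥ ⋯ ≥ λ_r(A)`. -/
def IsTopProjection {d : ℕ} (A : Matrix (Fin d) (Fin d) ℝ) (r : ℕ)
    (P : Matrix (Fin d) (Fin d) ℝ) : Prop :=
  ∃ U : Matrix (Fin d) (Fin r) ℝ, U.transpose * U = 1 ∧
    A * U = U * Matrix.diagonal (fun q : Fin r => eig A (q.val + 1)) ∧ P = proj U

/-- Orthogonality of global and local principal components on one client: the covariance `S` is the
orthogonal direct sum of `Sg` (global components) and `Sl` (local components), and `Pg`, `Pl` are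
the projections onto the top `r₁` global and the top `r₂` local principal components. -/
structure CovarianceDecomposition {d : ℕ} (r₁ r₂ : ℕ)
    (S Sg Sl Pg Pl : Matrix (Fin d) (Fin d) ℝ) : Prop where
  global_posSemidef : Sg.PosSemidef
  local_posSemidef : Sl.PosSemidef
  sum_eq : S = Sg + Sl
  orthogonal : Sg * Sl = 0
  global_top : IsTopProjection Sg r₁ Pg
  local_top : IsTopProjection Sl r₂ Pl
  global_col : col Pg ≤ col Sg
  local_col : col Pl ≤ col Sl

/-- A distribution on `ℝᵈ` is sub-Gaussian with parameter `σ` if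
`E exp (t ⟨v, y⟩) ≤ exp (t² σ² / 2)` for all unit vectors `v` and all real `t`. -/
def IsSubGaussian {d : ℕ} (σ : ℝ≥0) (ν : Measure (EuclideanSpace ℝ (Fin d))) : Prop :=
  ∀ v : EuclideanSpace ℝ (Fin d), ‖v‖ = 1 →
    HasSubgaussianMGF (fun y : EuclideanSpace ℝ (Fin d) => inner ℝ v y) (σ ^ 2) ν

/-- The covariance matrix of a distribution on `ℝᵈ`. -/
def covMatrix {d : ℕ} (ν : Measure (EuclideanSpace ℝ (Fin d))) : Matrix (Fin d) (Fin d) ℝ :=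
  Matrix.of fun a b => covariance (fun y => y a) (fun y => y b) ν

/-- The data covariance matrix `(1 / n) Y Yᵀ` of `n` observations, the columns of `Y`. -/
def sampleCov {d n : ℕ} (y : Fin n → EuclideanSpace ℝ (Fin d)) : Matrix (Fin d) (Fin d) ℝ :=
  let Y : Matrix (Fin d) (Fin n) ℝ := Matrix.of fun a j => y j a
  (1 / (n : ℝ)) • (Y * Y.transpose)

/-- The constraints: `UᵀU = I`, `V_iᵀ V_i = I`, `V_iᵀ U = 0` for all `i`. -/
def Feasible {d N r₁ : ℕ} {r₂ : Fin N → ℕ} (U : Matrix (Fin d) (Fin r₁) ℝ)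
    (V : (i : Fin N) → Matrix (Fin d) (Fin (r₂ i)) ℝ) : Prop :=
  U.transpose * U = 1 ∧ ∀ i, (V i).transpose * V i = 1 ∧ (V i).transpose * U = 0

/-- The objective `½ ∑ i, [Tr (Uᵀ S_i U) + Tr (V_iᵀ S_i V_i)]`. -/
def objective {d N r₁ : ℕ} {r₂ : Fin N → ℕ} (S : Fin N → Matrix (Fin d) (Fin d) ℝ)
    (U : Matrix (Fin d) (Fin r₁) ℝ) (V : (i : Fin N) → Matrix (Fin d) (Fin (r₂ i)) ℝ) : ℝ :=
  1 / 2 * ∑ i, ((U.transpose * S i * U).trace + ((V i).transpose * S i * V i).trace)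

/-- `(U, V)` maximizes the objective under the constraints. -/
def IsOptimal {d N r₁ : ℕ} {r₂ : Fin N → ℕ} (S : Fin N → Matrix (Fin d) (Fin d) ℝ)
    (U : Matrix (Fin d) (Fin r₁) ℝ) (V : (i : Fin N) → Matrix (Fin d) (Fin (r₂ i)) ℝ) : Prop :=
  Feasible U V ∧
    ∀ (U' : Matrix (Fin d) (Fin r₁) ℝ) (V' : (i : Fin N) → Matrix (Fin d) (Fin (r₂ i)) ℝ),
      Feasible U' V' → objective S U' V' ≤ objective S U V

/-- The subspace error `‖P_U - Π_g‖_F² + (1 / N) ∑ i, ‖P_{V_i} - Π_i‖_F²`. -/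
def subspaceError {d N r₁ : ℕ} {r₂ : Fin N → ℕ} (Pg : Matrix (Fin d) (Fin d) ℝ)
    (Pl : Fin N → Matrix (Fin d) (Fin d) ℝ) (U : Matrix (Fin d) (Fin r₁) ℝ)
    (V : (i : Fin N) → Matrix (Fin d) (Fin (r₂ i)) ℝ) : ℝ :=
  frobSq (proj U - Pg) + 1 / (N : ℝ) * ∑ i, frobSq (proj (V i) - Pl i)

/-- `A` holds with probability at least `p`: on an event of probability at least `p`. -/
def HoldsWithProb {Ω : Type*} [MeasurableSpace Ω] (P : Measure Ω) (p : ℝ) (A : Ω → Prop) : Prop :=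
  ∃ E : Set Ω, MeasurableSet E ∧ p ≤ P.real E ∧ ∀ ω ∈ E, A ω

end

end PerPCA

namespace PerPCA

open Matrix

/-! Write `T_i = Pg + Pl i` and `R_i = proj U + proj (V i)`. Orthogonality makes `T_i` a spectral
projection of the whole covariance, with gap at least `δ` between its range and its complement.
Hence replacing `T_i` by another projection of the same rank costs at least `δ / 2 * ‖T_i - R_i‖²`
in trace (`SpectralSplit.frobSq_le`). The true projections are feasible, so a maximizer loses
nothing for the data matrices `S i`. The cost is therefore paid by the error of `S i`, and Young's
inequality bounds the mean of `‖T_i - R_i‖²` by `4 / δ²` times the mean squared error of the `S i`.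
Identifiability separates the global from the local part at a factor `5 / θ` (`sum_frobSq_proj_le`),
giving `subspaceError_le`.

The random input is `measureReal_lt_frobSq_le`: a Bernstein-type bound for squares of sub-Gaussian
variables on a `1/2`-net of the sphere controls the operator norm of the covariance error, and the
Frobenius norm costs another factor `d`. This holds in the regime `d + u ≤ n`, which is automatic:
the gap is at most `2 σ²` (`eigengap_le_two_mul_sq`) and the claim is trivial for `ε > 4 d`. A union
bound over clients finishes without independence between them. -/

theorem dotProduct_self_nonneg {n : Type*} [Fintype n] (x : n → ℝ) : 0 ≤ x ⬝ᵥ x :=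
  Finset.sum_nonneg fun _ _ => mul_self_nonneg _

/-- Orthogonal projection matrices. -/
structure IsOrthProj {d : ℕ} (P : Matrix (Fin d) (Fin d) ℝ) : Prop where
  transpose_eq : Pᵀ = P
  mul_self : P * P = P

/-- `P` is an orthogonal projection commuting with the symmetric matrix `A`, with `A ≥ a` on the
range of `P` and `A ≤ b` on its orthogonal complement. -/
structure SpectralSplit {d : ℕ} (A P : Matrix (Fin d) (Fin d) ℝ) (a b : ℝ) : Prop where
  isOrthProj : IsOrthProj P
  comm : A * P = P * A
  lower : (A * P - a • P).PosSemidef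
  upper : (b • (1 - P) - A * (1 - P)).PosSemidef

/-! ### Projections, Frobenius norms and spectral splittings. -/

section LinearAlgebra

variable {d : ℕ} {A B P Q R : Matrix (Fin d) (Fin d) ℝ}

theorem isOrthProj_proj {r : ℕ} {U : Matrix (Fin d) (Fin r) ℝ} (h : Uᵀ * U = 1) :
    IsOrthProj (proj U) where
  transpose_eq := by simp [proj]
  mul_self := by
    rw [proj, Matrix.mul_assoc, ← Matrix.mul_assoc Uᵀ, h, Matrix.one_mul]

theorem trace_proj {r : ℕ} {U : Matrix (Fin d) (Fin r) ℝ} (h : Uᵀ * U = 1) :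
    (proj U).trace = r := by
  rw [proj, trace_mul_comm, h]; simp

namespace IsOrthProj

theorem compl (hP : IsOrthProj P) : IsOrthProj (1 - P) where
  transpose_eq := by simp [hP.transpose_eq]
  mul_self := by simp [Matrix.mul_sub, Matrix.sub_mul, hP.mul_self]

theorem add (hP : IsOrthProj P) (hQ : IsOrthProj Q) (h : P * Q = 0) : IsOrthProj (P + Q) where
  transpose_eq := by simp [hP.transpose_eq, hQ.transpose_eq]
  mul_self := by
    have h' : Q * P = 0 := by
      simpa [hP.transpose_eq, hQ.transpose_eq] using congrArg Matrix.transpose h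
    simp [Matrix.mul_add, Matrix.add_mul, hP.mul_self, hQ.mul_self, h, h']

theorem posSemidef_conj (hP : IsOrthProj P) (hA : A.PosSemidef) : (P * A * P).PosSemidef := by
  simpa [conjTranspose_eq_transpose_of_trivial, hP.transpose_eq] using
    hA.mul_mul_conjTranspose_same P

theorem posSemidef (hP : IsOrthProj P) : P.PosSemidef := by
  simpa [hP.mul_self] using hP.posSemidef_conj PosSemidef.one

theorem trace_mul_nonneg (hP : IsOrthProj P) (hA : A.PosSemidef) : 0 ≤ (A * P).trace := by
  have h := (hP.posSemidef_conj hA).trace_nonneg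
  rwa [Matrix.mul_assoc, trace_mul_comm, Matrix.mul_assoc, hP.mul_self] at h

theorem trace_le (hP : IsOrthProj P) : P.trace ≤ d := by
  have h := hP.compl.posSemidef.trace_nonneg
  rw [trace_sub, trace_one, Fintype.card_fin] at h
  linarith

end IsOrthProj

theorem frobSq_eq_trace (A : Matrix (Fin d) (Fin d) ℝ) : frobSq A = (A * Aᵀ).trace := by
  simp [frobSq, trace, mul_apply, sq]

theorem frobSq_nonneg (A : Matrix (Fin d) (Fin d) ℝ) : 0 ≤ frobSq A :=
  Finset.sum_nonneg fun _ _ => Finset.sum_nonneg fun _ _ => sq_nonneg _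

theorem frobSq_sub_proj (hP : IsOrthProj P) (hQ : IsOrthProj Q) :
    frobSq (P - Q) = P.trace + Q.trace - 2 * (P * Q).trace := by
  rw [frobSq_eq_trace, transpose_sub, hP.transpose_eq, hQ.transpose_eq]
  simp only [Matrix.mul_sub, Matrix.sub_mul, hP.mul_self, hQ.mul_self, trace_sub,
    trace_mul_comm Q P]
  ring

theorem frobSq_neg (A : Matrix (Fin d) (Fin d) ℝ) : frobSq (-A) = frobSq A := by
  simp [frobSq]

theorem frobSq_add_le (A B : Matrix (Fin d) (Fin d) ℝ) :
    frobSq (A + B) ≤ 2 * frobSq A + 2 * frobSq B := by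
  simp only [frobSq, Finset.mul_sum, ← Finset.sum_add_distrib]
  refine Finset.sum_le_sum fun a _ => Finset.sum_le_sum fun b _ => ?_
  rw [Matrix.add_apply]
  nlinarith [sq_nonneg (A a b - B a b)]

/-- Young's inequality entry by entry. The weight `δ / 4` is half of the curvature `δ / 2`, so that
this term can be absorbed. -/
theorem trace_mul_le_frobSq {δ : ℝ} (hδ : 0 < δ) (A B : Matrix (Fin d) (Fin d) ℝ)
    (hB : Bᵀ = B) : (A * B).trace ≤ 1 / δ * frobSq A + δ / 4 * frobSq B := by
  have : (A * B).trace = ∑ a, ∑ b, A a b * B a b := by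
    simp only [trace, diag, mul_apply]
    refine Finset.sum_congr rfl fun a _ => Finset.sum_congr rfl fun b _ => ?_
    conv_lhs => rw [← hB]
    rfl
  rw [this]
  simp only [frobSq, Finset.mul_sum, ← Finset.sum_add_distrib]
  refine Finset.sum_le_sum fun a _ => Finset.sum_le_sum fun b _ => ?_
  have h := sq_nonneg (A a b - δ / 2 * B a b)
  have h2 : 0 ≤ 1 / δ * (A a b - δ / 2 * B a b) ^ 2 := by positivity
  have h3 : 1 / δ * (A a b - δ / 2 * B a b) ^ 2 =
      1 / δ * A a b ^ 2 + δ / 4 * B a b ^ 2 - A a b * B a b := by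
    field_simp; ring
  linarith

/-- Add the traces of `(A P - a P)(1 - R)` and `(b (1 - P) - A (1 - P)) R`, both nonnegative: the
terms `A P R` cancel and equal ranks turn the rest into `frobSq (P - R)`. -/
theorem SpectralSplit.frobSq_le {a b : ℝ} (h : SpectralSplit A P a b) (hR : IsOrthProj R)
    (htr : R.trace = P.trace) :
    (a - b) / 2 * frobSq (P - R) ≤ (A * (P - R)).trace := by
  have h1 := hR.compl.trace_mul_nonneg h.lower
  have h2 := hR.trace_mul_nonneg h.upper
  rw [frobSq_sub_proj h.isOrthProj hR, htr]
  simp only [Matrix.mul_sub, Matrix.sub_mul, Matrix.mul_one, Matrix.one_mul, trace_sub,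
    smul_mul, trace_smul, smul_eq_mul, smul_sub, Matrix.mul_assoc] at h1 h2 ⊢
  rw [htr] at h2
  linarith

/-- If `0 ≤ A ≤ b` then `A² ≤ b A`. -/
theorem posSemidef_smul_sub_sq {b : ℝ} (hb : 0 < b) (hA : A.PosSemidef)
    (hAb : (b • 1 - A).PosSemidef) : (b • A - A * A).PosSemidef := by
  have h1 : (A * (b • 1 - A) * A).PosSemidef := by
    simpa [conjTranspose_eq_transpose_of_trivial, show Aᵀ = A from hA.1] using
      hAb.mul_mul_conjTranspose_same A
  have h2 : ((b • 1 - A) * A * (b • 1 - A)).PosSemidef := by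
    have := hA.mul_mul_conjTranspose_same (b • 1 - A)
    rwa [hAb.1] at this
  -- `b (b A - A²) = A (b - A) A + (b - A) A (b - A)`.
  have h3 := (h1.add h2).smul (inv_nonneg.2 hb.le)
  convert h3 using 1
  rw [eq_inv_smul_iff₀ hb.ne']
  simp only [Matrix.mul_sub, Matrix.sub_mul, smul_sub, Matrix.smul_mul, Matrix.mul_smul,
    Matrix.one_mul, Matrix.mul_one, Matrix.mul_assoc]
  abel

/-- Orthogonal summands share the bound `b` instead of adding up to `2 b`: since `A B = B A = 0`, `b
(b - A - B) = (b A - A²) + (b B - B²) + (b - A - B)²`. -/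
theorem posSemidef_smul_one_sub_add {b : ℝ} (hb : 0 ≤ b) (hA : A.PosSemidef) (hB : B.PosSemidef)
    (hAb : (b • 1 - A).PosSemidef) (hBb : (b • 1 - B).PosSemidef) (hAB : A * B = 0) :
    (b • 1 - (A + B)).PosSemidef := by
  rcases hb.eq_or_lt with rfl | hb
  · convert hAb.add hBb using 1
    simp [sub_eq_add_neg, add_comm]
  have hBA : B * A = 0 := by
    simpa [show Aᵀ = A from hA.1, show Bᵀ = B from hB.1] using congrArg Matrix.transpose hAB
  have h1 := posSemidef_smul_sub_sq hb hA hAb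
  have h2 := posSemidef_smul_sub_sq hb hB hBb
  have h3 : ((b • 1 - (A + B)) * (b • 1 - (A + B))).PosSemidef := by
    have := posSemidef_conjTranspose_mul_self (b • 1 - (A + B))
    rwa [show (b • 1 - (A + B))ᴴ = b • 1 - (A + B) by
      simp [conjTranspose_eq_transpose_of_trivial, show Aᵀ = A from hA.1,
        show Bᵀ = B from hB.1]] at this
  have h4 := ((h1.add h2).add h3).smul (inv_nonneg.2 hb.le)
  convert h4 using 1
  rw [eq_inv_smul_iff₀ hb.ne']
  simp only [Matrix.mul_sub, Matrix.sub_mul, Matrix.mul_add, Matrix.add_mul, smul_sub, smul_add,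
    Matrix.smul_mul, Matrix.mul_smul, Matrix.one_mul, Matrix.mul_one, hAB, hBA]
  abel

theorem mul_compl_posSemidef (hA : A.PosSemidef) (hP : IsOrthProj P) (h : A * P = P * A) :
    (A * (1 - P)).PosSemidef := by
  have := hP.compl.posSemidef_conj hA
  rwa [Matrix.mul_assoc, show A * (1 - P) = (1 - P) * A by
    simp [Matrix.mul_sub, Matrix.sub_mul, h], ← Matrix.mul_assoc, hP.compl.mul_self,
    ← show A * (1 - P) = (1 - P) * A by simp [Matrix.mul_sub, Matrix.sub_mul, h]] at this

theorem SpectralSplit.add {a b : ℝ} (hb : 0 ≤ b) (hA : SpectralSplit A P a b)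
    (hB : SpectralSplit B Q a b) (hA' : A.PosSemidef) (hB' : B.PosSemidef) (hAB : A * B = 0)
    (hAQ : A * Q = 0) (hBP : B * P = 0) (hPQ : P * Q = 0) :
    SpectralSplit (A + B) (P + Q) a b := by
  have tA : Aᵀ = A := hA'.1
  have tB : Bᵀ = B := hB'.1
  have hQA : Q * A = 0 := by
    simpa [tA, hB.isOrthProj.transpose_eq] using congrArg Matrix.transpose hAQ
  have hPB : P * B = 0 := by
    simpa [tB, hA.isOrthProj.transpose_eq] using congrArg Matrix.transpose hBP
  have hT := hA.isOrthProj.add hB.isOrthProj hPQ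
  refine ⟨hT, ?_, ?_, ?_⟩
  · rw [Matrix.mul_add, Matrix.add_mul, Matrix.add_mul, hAQ, hBP, Matrix.mul_add, Matrix.add_mul,
      Matrix.add_mul, hQA, hPB, hA.comm, hB.comm]
  · convert hA.lower.add hB.lower using 1
    simp only [Matrix.mul_add, Matrix.add_mul, hAQ, hBP, smul_add]
    abel
  · have pA := mul_compl_posSemidef hA' hA.isOrthProj hA.comm
    have pB := mul_compl_posSemidef hB' hB.isOrthProj hB.comm
    -- Adding `b P ≥ 0` replaces the bound off the range of `P` by a bound on the whole space, where
    -- the two remainders can be added; conjugation by `1 - (P + Q)` restricts again.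
    have uA : (b • 1 - A * (1 - P)).PosSemidef := by
      convert hA.upper.add (hA.isOrthProj.posSemidef.smul hb) using 1
      simp only [smul_sub]; abel
    have uB : (b • 1 - B * (1 - Q)).PosSemidef := by
      convert hB.upper.add (hB.isOrthProj.posSemidef.smul hb) using 1
      simp only [smul_sub]; abel
    have h0 : A * (1 - P) * (B * (1 - Q)) = 0 := by
      rw [Matrix.mul_assoc, ← Matrix.mul_assoc (1 - P)]
      simp only [Matrix.sub_mul, hPB, Matrix.one_mul, sub_zero]
      rw [← Matrix.mul_assoc, hAB, Matrix.zero_mul]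
    have h1 := hT.compl.posSemidef_conj (posSemidef_smul_one_sub_add hb pA pB uA uB h0)
    have key : (A * (1 - P) + B * (1 - Q)) * (1 - (P + Q)) = (A + B) * (1 - (P + Q)) := by
      have e1 : A * (1 - P) * (1 - (P + Q)) = A * (1 - (P + Q)) := by
        rw [Matrix.mul_assoc]; congr 1
        simp only [Matrix.mul_sub, Matrix.sub_mul, Matrix.mul_add, Matrix.mul_one, Matrix.one_mul,
          hA.isOrthProj.mul_self, hPQ]; abel
      have hQP : Q * P = 0 := by
        simpa [hA.isOrthProj.transpose_eq, hB.isOrthProj.transpose_eq] using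
          congrArg Matrix.transpose hPQ
      have e2 : B * (1 - Q) * (1 - (P + Q)) = B * (1 - (P + Q)) := by
        rw [Matrix.mul_assoc]; congr 1
        simp only [Matrix.mul_sub, Matrix.sub_mul, Matrix.mul_add, Matrix.mul_one, Matrix.one_mul,
          hB.isOrthProj.mul_self, hQP]; abel
      rw [Matrix.add_mul, e1, e2, Matrix.add_mul]
    have hc : (1 - (P + Q)) * (A + B) = (A + B) * (1 - (P + Q)) := by
      simp only [Matrix.mul_sub, Matrix.sub_mul, Matrix.mul_add, Matrix.add_mul, Matrix.mul_one,
        Matrix.one_mul, hAQ, hBP, hQA, hPB, hA.comm, hB.comm]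
      abel
    convert h1 using 1
    rw [Matrix.mul_assoc, Matrix.sub_mul (b • 1), key, Matrix.mul_sub (1 - (P + Q)),
      ← Matrix.mul_assoc _ (A + B), hc, Matrix.mul_assoc (A + B), hT.compl.mul_self, smul_mul,
      Matrix.one_mul, Matrix.mul_smul, hT.compl.mul_self]

/-! ### Ordered eigenvalues and quadratic forms. -/

theorem eig_eq (hA : A.IsHermitian) {k : ℕ} (h1 : 1 ≤ k) (h2 : k ≤ d) :
    eig A k = hA.eigenvalues₀ ⟨k - 1, by rw [Fintype.card_fin]; omega⟩ :=
  dif_pos ⟨hA, h1, h2⟩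

theorem eig_anti (hA : A.IsHermitian) {k l : ℕ} (h1 : 1 ≤ k) (hkl : k ≤ l) (h2 : l ≤ d) :
    eig A l ≤ eig A k := by
  rw [eig_eq hA h1 (hkl.trans h2), eig_eq hA (h1.trans hkl) h2]
  exact hA.eigenvalues₀_antitone (Fin.mk_le_mk.2 (by omega))

theorem eig_nonneg {A : Matrix (Fin d) (Fin d) ℝ} (hA : A.PosSemidef) {k : ℕ} (h1 : 1 ≤ k)
    (h2 : k ≤ d) : 0 ≤ eig A k := by
  rw [eig_eq hA.1 h1 h2]
  have := hA.eigenvalues_nonneg (Fintype.equivOfCardEq (Fintype.card_fin (Fintype.card (Fin d)))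
    ⟨k - 1, by rw [Fintype.card_fin]; omega⟩)
  simpa [IsHermitian.eigenvalues] using this

/-- The position `k` is kept explicit, so that eigenvalues above a threshold can be counted by their
rank in the decreasing order; `eig` is one-based, hence `k + 1`. -/
theorem exists_eigenvalues_eq_eig (hA : A.IsHermitian) (i : Fin d) :
    ∃ k : ℕ, k = (Fintype.equivOfCardEq (Fintype.card_fin (Fintype.card (Fin d)))).symm i ∧
      k + 1 ≤ d ∧ hA.eigenvalues i = eig A (k + 1) := by
  set j := (Fintype.equivOfCardEq (Fintype.card_fin (Fintype.card (Fin d)))).symm i with hj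
  have hjd : (j : ℕ) < d := by simpa using j.2
  refine ⟨j, rfl, hjd, ?_⟩
  rw [eig_eq hA (by omega) hjd]
  rfl

theorem eigenvalues_le_eig_one (hA : A.IsHermitian) (i : Fin d) : hA.eigenvalues i ≤ eig A 1 := by
  obtain ⟨k, -, hk, h⟩ := exists_eigenvalues_eq_eig hA i
  exact h.trans_le (eig_anti hA le_rfl (by omega) hk)

theorem dotProduct_mulVec_eq_sum (hA : A.IsHermitian) (x : Fin d → ℝ) :
    x ⬝ᵥ (A *ᵥ x) = ∑ k, hA.eigenvalues k *
      (((hA.eigenvectorUnitary : Matrix (Fin d) (Fin d) ℝ)ᵀ *ᵥ x) k) ^ 2 := by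
  set V : Matrix (Fin d) (Fin d) ℝ := ↑hA.eigenvectorUnitary
  have h : A = V * diagonal hA.eigenvalues * Vᵀ := by
    simpa [Unitary.conjStarAlgAut_apply, star_eq_conjTranspose,
      conjTranspose_eq_transpose_of_trivial, Function.comp_def] using hA.spectral_theorem
  have h2 : A *ᵥ x = V *ᵥ (diagonal hA.eigenvalues *ᵥ (Vᵀ *ᵥ x)) := by
    rw [mulVec_mulVec, mulVec_mulVec, ← h]
  rw [h2, dotProduct_mulVec, ← mulVec_transpose]
  simp only [dotProduct, mulVec_diagonal]
  exact Finset.sum_congr rfl fun k _ => by ring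

theorem dotProduct_self_eq_sum (hA : A.IsHermitian) (x : Fin d → ℝ) :
    x ⬝ᵥ x =
      ∑ k, (((hA.eigenvectorUnitary : Matrix (Fin d) (Fin d) ℝ)ᵀ *ᵥ x) k) ^ 2 := by
  set V : Matrix (Fin d) (Fin d) ℝ := ↑hA.eigenvectorUnitary
  have h : V * Vᵀ = 1 := by
    simpa [star_eq_conjTranspose, conjTranspose_eq_transpose_of_trivial] using
      Unitary.coe_mul_star_self hA.eigenvectorUnitary
  have h2 : x = V *ᵥ (Vᵀ *ᵥ x) := by rw [mulVec_mulVec, h, one_mulVec]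
  conv_lhs => rw [h2, dotProduct_mulVec, ← mulVec_transpose, ← h2]
  simp [dotProduct, sq]

theorem dotProduct_mulVec_le_of_eigenvalues_le (hA : A.IsHermitian) {b : ℝ}
    (h : ∀ k, hA.eigenvalues k ≤ b) (x : Fin d → ℝ) : x ⬝ᵥ (A *ᵥ x) ≤ b * (x ⬝ᵥ x) := by
  rw [dotProduct_mulVec_eq_sum hA, dotProduct_self_eq_sum hA, Finset.mul_sum]
  exact Finset.sum_le_sum fun k _ => mul_le_mul_of_nonneg_right (h k) (sq_nonneg _)

theorem posSemidef_smul_one_sub (hA : A.IsHermitian) {b : ℝ}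
    (h : ∀ x : Fin d → ℝ, x ⬝ᵥ (A *ᵥ x) ≤ b * (x ⬝ᵥ x)) : (b • 1 - A).PosSemidef := by
  refine PosSemidef.of_dotProduct_mulVec_nonneg ?_ fun x => ?_
  · rw [IsHermitian, conjTranspose_sub, hA.eq]; simp
  · simpa [sub_mulVec, smul_mulVec] using h x

/-- On the orthogonal complement of `r` top eigenvectors, the quadratic form of `A` is at most
`λ_{r+1}(A)`, provided that `λ_r(A) > λ_{r+1}(A)`. -/
theorem dotProduct_mulVec_le_eig_succ (hA : A.IsHermitian) {r : ℕ}
    (hd : r + 1 ≤ d) (hgap : eig A (r + 1) < eig A r) {U : Matrix (Fin d) (Fin r) ℝ}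
    (hU : Uᵀ * U = 1) (hAU : A * U = U * diagonal (fun q : Fin r => eig A (q.val + 1)))
    {x : Fin d → ℝ} (hx : Uᵀ *ᵥ x = 0) : x ⬝ᵥ (A *ᵥ x) ≤ eig A (r + 1) * (x ⬝ᵥ x) := by
  by_contra! hlt
  set b := eig A (r + 1) with hb
  set V : Matrix (Fin d) (Fin d) ℝ := ↑hA.eigenvectorUnitary with hV
  let w : (Fin r → ℝ) × ℝ →ₗ[ℝ] (Fin d → ℝ) :=
    U.mulVecLin.coprod (LinearMap.toSpanSingleton ℝ _ x)
  have hw : ∀ p, w p = U *ᵥ p.1 + p.2 • x := fun p => by simp [w]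
  let K : Finset (Fin d) := Finset.univ.filter fun k => b < hA.eigenvalues k
  have hK : K.card ≤ r := by
    have : K.card ≤ (Finset.range r).card := by
      refine Finset.card_le_card_of_injOn
        (fun i => ((Fintype.equivOfCardEq (Fintype.card_fin (Fintype.card (Fin d)))).symm i : ℕ))
        (fun i hi => ?_) fun i _ j _ hij => by simpa [Fin.val_inj] using hij
      obtain ⟨k, hk, hkd, he⟩ := exists_eigenvalues_eq_eig hA i
      have hi' : b < hA.eigenvalues i := by simpa [K] using hi
      simp only [← hk, Finset.coe_range, Set.mem_Iio]
      by_contra! hr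
      exact absurd (eig_anti hA (by omega : 1 ≤ r + 1) (by omega : r + 1 ≤ k + 1) hkd)
        (not_le.2 (he ▸ hi'))
    simpa using this
  let F : (Fin r → ℝ) × ℝ →ₗ[ℝ] (K → ℝ) :=
    (LinearMap.funLeft ℝ ℝ (Subtype.val : K → Fin d)) ∘ₗ Vᵀ.mulVecLin ∘ₗ w
  have hF : LinearMap.ker F ≠ ⊥ := by
    refine LinearMap.ker_ne_bot_of_finrank_lt ?_
    simp only [Module.finrank_fintype_fun_eq_card, Module.finrank_prod, Fintype.card_coe,
      Fintype.card_fin, Module.finrank_self]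
    omega
  obtain ⟨⟨a, c⟩, hp, hp0⟩ := Submodule.exists_mem_ne_zero_of_ne_bot hF
  set y := w (a, c) with hy
  have hyK : ∀ k ∈ K, (Vᵀ *ᵥ y) k = 0 := fun k hk => congrFun (LinearMap.mem_ker.1 hp) ⟨k, hk⟩
  have hupper : y ⬝ᵥ (A *ᵥ y) ≤ b * (y ⬝ᵥ y) := by
    rw [dotProduct_mulVec_eq_sum hA, dotProduct_self_eq_sum hA, Finset.mul_sum]
    refine Finset.sum_le_sum fun k _ => ?_
    by_cases hk : k ∈ K
    · rw [← hV, hyK k hk]; simp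
    · exact mul_le_mul_of_nonneg_right (by simpa [K] using hk) (sq_nonneg _)
  have hUa : ∀ z, (U *ᵥ a) ⬝ᵥ z = a ⬝ᵥ (Uᵀ *ᵥ z) := fun z => by
    rw [dotProduct_mulVec, vecMul_transpose]
  have hzU : ∀ z, z ⬝ᵥ (U *ᵥ a) = a ⬝ᵥ (Uᵀ *ᵥ z) := fun z => by rw [dotProduct_comm, hUa]
  have hAUa : A *ᵥ (U *ᵥ a) =
      U *ᵥ (diagonal (fun q : Fin r => eig A (q.val + 1)) *ᵥ a) := by
    rw [mulVec_mulVec, hAU, mulVec_mulVec]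
  have hxU : ∀ z, x ⬝ᵥ (U *ᵥ z) = 0 := fun z => by
    rw [dotProduct_mulVec, ← mulVec_transpose, hx, zero_dotProduct]
  have hUAx : Uᵀ *ᵥ (A *ᵥ x) = 0 := by
    have : Uᵀ * A = diagonal (fun q : Fin r => eig A (q.val + 1)) * Uᵀ := by
      simpa [show Aᵀ = A from hA] using congrArg Matrix.transpose hAU
    rw [mulVec_mulVec, this, ← mulVec_mulVec, hx, mulVec_zero]
  have e1 : y ⬝ᵥ y = a ⬝ᵥ a + c ^ 2 * (x ⬝ᵥ x) := by
    rw [hy, hw]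
    simp only [add_dotProduct, dotProduct_add, smul_dotProduct, dotProduct_smul, hxU, hUa, hx,
      mulVec_mulVec, hU, one_mulVec, smul_eq_mul, dotProduct_zero]
    ring
  have e2 : y ⬝ᵥ (A *ᵥ y) =
      a ⬝ᵥ (diagonal (fun q : Fin r => eig A (q.val + 1)) *ᵥ a) + c ^ 2 * (x ⬝ᵥ (A *ᵥ x)) := by
    rw [hy, hw]
    simp only [mulVec_add, mulVec_smul, add_dotProduct, dotProduct_add, smul_dotProduct,
      dotProduct_smul, hAUa, hxU, hUa, hUAx, smul_eq_mul, dotProduct_zero]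
    rw [mulVec_mulVec, hU, one_mulVec]
    ring
  have e3 : eig A r * (a ⬝ᵥ a) ≤
      a ⬝ᵥ (diagonal (fun q : Fin r => eig A (q.val + 1)) *ᵥ a) := by
    simp only [dotProduct, mulVec_diagonal, Finset.mul_sum]
    refine Finset.sum_le_sum fun q _ => ?_
    have := eig_anti hA (by omega : 1 ≤ q.val + 1) (by omega : q.val + 1 ≤ r) (by omega)
    nlinarith [mul_self_nonneg (a q)]
  rw [e1, e2] at hupper
  have ha : 0 ≤ a ⬝ᵥ a := dotProduct_self_nonneg a
  have hc : c ^ 2 = 0 := by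
    by_contra hc
    have hc : 0 < c ^ 2 := lt_of_le_of_ne (sq_nonneg c) (Ne.symm hc)
    nlinarith
  have ha0 : a ⬝ᵥ a = 0 := by
    rw [hc] at hupper
    nlinarith
  exact hp0 (Prod.ext (dotProduct_self_eq_zero.1 ha0) (pow_eq_zero_iff two_ne_zero |>.1 hc))

theorem IsTopProjection.isOrthProj {r : ℕ} (h : IsTopProjection A r P) : IsOrthProj P := by
  obtain ⟨U, hU, -, rfl⟩ := h
  exact isOrthProj_proj hU

theorem IsTopProjection.trace_eq {r : ℕ} (h : IsTopProjection A r P) : P.trace = r := by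
  obtain ⟨U, hU, -, rfl⟩ := h
  exact trace_proj hU

theorem IsTopProjection.spectralSplit {r : ℕ} (h : IsTopProjection A r P) (hA : A.IsHermitian)
    (hd : r + 1 ≤ d) (hgap : eig A (r + 1) < eig A r) {a b : ℝ} (ha : a ≤ eig A r)
    (hb : eig A (r + 1) ≤ b) : SpectralSplit A P a b := by
  have hP := h.isOrthProj
  obtain ⟨U, hU, hAU, rfl⟩ := h
  set D := diagonal (fun q : Fin r => eig A (q.val + 1)) with hD
  have tA : Aᵀ = A := hA
  have hUA : Uᵀ * A = D * Uᵀ := by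
    simpa [tA, hD] using congrArg Matrix.transpose hAU
  have hAP : A * proj U = U * D * Uᵀ := by rw [proj, ← Matrix.mul_assoc, hAU]
  have hcomm : A * proj U = proj U * A := by
    rw [hAP, proj, Matrix.mul_assoc, Matrix.mul_assoc, hUA]
  refine ⟨hP, hcomm, ?_, ?_⟩
  · have hDa : (D - a • 1).PosSemidef := by
      rw [hD, smul_one_eq_diagonal, diagonal_sub]
      refine PosSemidef.diagonal fun q => sub_nonneg.2 (ha.trans ?_)
      exact eig_anti hA (by omega) (by omega) (by omega)
    have := hDa.mul_mul_conjTranspose_same U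
    rw [hAP, proj]
    simpa [conjTranspose_eq_transpose_of_trivial, Matrix.mul_sub, Matrix.sub_mul] using this
  · have hc : A * (1 - proj U) = (1 - proj U) * A * (1 - proj U) := by
      rw [Matrix.sub_mul 1, Matrix.one_mul, ← hcomm]
      simp only [Matrix.mul_sub, Matrix.sub_mul, Matrix.mul_one, Matrix.mul_assoc, hP.mul_self]
      abel
    have hquad : ∀ x : Fin d → ℝ, x ⬝ᵥ ((A * (1 - proj U)) *ᵥ x) ≤
        b * (x ⬝ᵥ ((1 - proj U) *ᵥ x)) := fun x => by
      set z := (1 - proj U) *ᵥ x with hz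
      have h0 : Uᵀ *ᵥ z = 0 := by
        rw [hz, mulVec_mulVec, Matrix.mul_sub, proj, ← Matrix.mul_assoc, hU]; simp
      have hmv : ∀ M : Matrix (Fin d) (Fin d) ℝ,
          x ⬝ᵥ (((1 - proj U) * M) *ᵥ x) = z ⬝ᵥ (M *ᵥ x) := fun M => by
        rw [← mulVec_mulVec, dotProduct_mulVec, ← mulVec_transpose, hP.compl.transpose_eq]
      have h1 := dotProduct_mulVec_le_eig_succ hA hd hgap hU hAU h0
      have h2 : x ⬝ᵥ z = z ⬝ᵥ z := by
        rw [hz, ← hmv, hP.compl.mul_self]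
      rw [hc, Matrix.mul_assoc, hmv, ← mulVec_mulVec, ← hz, h2]
      exact h1.trans (mul_le_mul_of_nonneg_right hb (dotProduct_self_nonneg z))
    refine PosSemidef.of_dotProduct_mulVec_nonneg ?_ fun x => ?_
    · have t1 : (A * (1 - proj U))ᵀ = A * (1 - proj U) := by
        rw [transpose_mul, tA, hP.compl.transpose_eq, Matrix.sub_mul, Matrix.mul_sub, hcomm]
        simp
      rw [IsHermitian, conjTranspose_eq_transpose_of_trivial, transpose_sub, t1, transpose_smul,
        hP.compl.transpose_eq]
    · simpa [sub_mulVec, smul_mulVec] using hquad x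

end LinearAlgebra

/-! ### Deterministic error bound for maximizers. -/

section Deterministic

variable {d : ℕ}

theorem mul_eq_zero_of_col_le {A B P : Matrix (Fin d) (Fin d) ℝ} (hBA : B * A = 0)
    (h : col P ≤ col A) : B * P = 0 := by
  refine Matrix.toLin'.injective (LinearMap.ext fun x => ?_)
  obtain ⟨z, hz⟩ := h (LinearMap.mem_range_self P.mulVecLin x)
  rw [mulVecLin_apply, mulVecLin_apply] at hz
  simp only [toLin'_apply, LinearMap.zero_apply, map_zero, ← mulVec_mulVec, ← hz]
  rw [mulVec_mulVec, hBA, zero_mulVec]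

/-- Identifiability turns errors in the sums of projections into errors in the projections. -/
theorem sum_frobSq_proj_le {N : ℕ} {θ : ℝ} (hθ : 0 < θ) (hθ1 : θ < 1) (hN : 0 < N)
    {P Pg : Matrix (Fin d) (Fin d) ℝ} {Q Pl : Fin N → Matrix (Fin d) (Fin d) ℝ}
    (hP : IsOrthProj P) (hPg : IsOrthProj Pg) (hQ : ∀ i, IsOrthProj (Q i))
    (hPl : ∀ i, IsOrthProj (Pl i)) (hPQ : ∀ i, P * Q i = 0) (hPgl : ∀ i, Pg * Pl i = 0)
    (htr : P.trace = Pg.trace) (htr' : ∀ i, (Q i).trace = (Pl i).trace)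
    (hid : ((1 - θ) • 1 - (1 / (N : ℝ)) • ∑ i, Pl i).PosSemidef) :
    frobSq (P - Pg) + 1 / (N : ℝ) * ∑ i, frobSq (Q i - Pl i) ≤
      5 / θ * (1 / (N : ℝ) * ∑ i, frobSq (Pg + Pl i - (P + Q i))) := by
  have hN' : (0 : ℝ) < N := by exact_mod_cast hN
  have hPlg : ∀ i, Pl i * Pg = 0 := fun i => by
    simpa [(hPl i).transpose_eq, hPg.transpose_eq] using congrArg Matrix.transpose (hPgl i)
  have hT := fun i => hPg.add (hPl i) (hPgl i)
  have hR := fun i => hP.add (hQ i) (hPQ i)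
  have hX := frobSq_sub_proj hP hPg
  have hD : ∀ i, frobSq (Pg + Pl i - (P + Q i)) =
      2 * (((1 - (Pg + Pl i)) * P).trace + ((1 - (Pg + Pl i)) * Q i).trace) := fun i => by
    rw [frobSq_sub_proj (hT i) (hR i)]
    simp only [Matrix.sub_mul, Matrix.one_mul, Matrix.mul_add, trace_add, trace_sub, htr, htr' i]
    ring
  have hDP : ∀ i, 2 * ((1 - (Pg + Pl i)) * P).trace ≤ frobSq (Pg + Pl i - (P + Q i)) := fun i => by
    have := (hQ i).trace_mul_nonneg (hT i).compl.posSemidef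
    rw [hD]; linarith
  -- Compressing identifiability to the complement of `Pg` bounds the mean of `Pl i` by `(1 - θ) (1
  -- - Pg)`. Averaging `hDP` thus leaves `2 θ` times the trace of `(1 - Pg) P`, which is `θ * frobSq
  -- (P - Pg)`.
  have hglob : θ * frobSq (P - Pg) ≤ 1 / (N : ℝ) * ∑ i, frobSq (Pg + Pl i - (P + Q i)) := by
    have h1 := hP.trace_mul_nonneg (hPg.compl.posSemidef_conj hid)
    have h2 : (1 - Pg) * ((1 - θ) • 1 - (1 / (N : ℝ)) • ∑ i, Pl i) * (1 - Pg) =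
        (1 - θ) • (1 - Pg) - (1 / (N : ℝ)) • ∑ i, Pl i := by
      have e1 : Pg * ∑ i, Pl i = 0 := by simp [Finset.mul_sum, hPgl]
      have e2 : (∑ i, Pl i) * Pg = 0 := by simp [Finset.sum_mul, hPlg]
      simp only [Matrix.mul_sub, Matrix.sub_mul, Matrix.mul_smul, Matrix.smul_mul, Matrix.mul_one,
        Matrix.one_mul, hPg.mul_self, e1, e2, Matrix.zero_mul]
      simp
    have h3 : ∑ i, 2 * ((1 - (Pg + Pl i)) * P).trace ≤
        ∑ i, frobSq (Pg + Pl i - (P + Q i)) := Finset.sum_le_sum fun i _ => hDP i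
    rw [h2] at h1
    simp only [Matrix.sub_mul, Matrix.add_mul, Matrix.smul_mul, Matrix.one_mul, Finset.sum_mul,
      trace_sub, trace_add, trace_smul, trace_sum, smul_eq_mul] at h1 h3
    rw [← Finset.mul_sum, Finset.sum_sub_distrib, Finset.sum_add_distrib] at h3
    simp only [Finset.sum_const, Finset.card_univ, Fintype.card_fin, nsmul_eq_mul] at h3
    have h4 := mul_le_mul_of_nonneg_left h3 (by positivity : 0 ≤ 1 / (N : ℝ))
    have h5 : 1 / (N : ℝ) * (2 * (N * P.trace - (N * (Pg * P).trace +
        ∑ i, (Pl i * P).trace))) = 2 * (P.trace - (Pg * P).trace -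
        1 / (N : ℝ) * ∑ i, (Pl i * P).trace) := by
      field_simp; ring
    rw [h5] at h4
    refine le_trans ?_ h4
    rw [hX, ← htr, trace_mul_comm P Pg]
    linarith
  have hloc : ∀ i, frobSq (Q i - Pl i) ≤
      2 * frobSq (Pg + Pl i - (P + Q i)) + 2 * frobSq (P - Pg) := fun i => by
    have h := frobSq_add_le (Pg + Pl i - (P + Q i)) (P - Pg)
    rwa [show Pg + Pl i - (P + Q i) + (P - Pg) = -(Q i - Pl i) by abel, frobSq_neg] at h
  have h1 : 1 / (N : ℝ) * ∑ i, frobSq (Q i - Pl i) ≤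
      2 * (1 / (N : ℝ) * ∑ i, frobSq (Pg + Pl i - (P + Q i))) + 2 * frobSq (P - Pg) := by
    have h := mul_le_mul_of_nonneg_left (Finset.sum_le_sum fun i (_ : i ∈ Finset.univ) => hloc i)
      (by positivity : 0 ≤ 1 / (N : ℝ))
    refine h.trans_eq ?_
    rw [Finset.sum_add_distrib, ← Finset.mul_sum]
    simp only [Finset.sum_const, Finset.card_univ, Fintype.card_fin, nsmul_eq_mul]
    field_simp
  set m := 1 / (N : ℝ) * ∑ i, frobSq (Pg + Pl i - (P + Q i)) with hm
  have hm0 : 0 ≤ m := mul_nonneg (by positivity) (Finset.sum_nonneg fun i _ => frobSq_nonneg _)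
  have hg : frobSq (P - Pg) ≤ m / θ := by rwa [le_div_iff₀' hθ]
  have hmθ : m ≤ m / θ := by
    rw [le_div_iff₀ hθ]; nlinarith
  -- The global error is at most `m / θ`, the mean local one at most `2 m + 2 m / θ`, and `m ≤ m /
  -- θ`.
  calc _ ≤ 5 * (m / θ) := by linarith
    _ = 5 / θ * m := by ring

variable {r₁ r₂ : ℕ} {S Sg Sl Pg Pl : Matrix (Fin d) (Fin d) ℝ}

namespace CovarianceDecomposition

theorem proj_mul_eq_zero (h : CovarianceDecomposition r₁ r₂ S Sg Sl Pg Pl) : Pg * Pl = 0 := by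
  have h1 : Sg * Pl = 0 := mul_eq_zero_of_col_le h.orthogonal h.local_col
  have h2 : Pl * Sg = 0 := by
    simpa [show Sgᵀ = Sg from h.global_posSemidef.1, h.local_top.isOrthProj.transpose_eq] using
      congrArg Matrix.transpose h1
  have h3 : Pl * Pg = 0 := mul_eq_zero_of_col_le h2 h.global_col
  simpa [h.global_top.isOrthProj.transpose_eq, h.local_top.isOrthProj.transpose_eq] using
    congrArg Matrix.transpose h3

/-- With both ranks positive, this puts the indices `r₁ + 1` and `r₂ + 1` in the range of `eig`, so
its default value plays no role. -/
theorem add_le (h : CovarianceDecomposition r₁ r₂ S Sg Sl Pg Pl) : r₁ + r₂ ≤ d := by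
  have := (h.global_top.isOrthProj.add h.local_top.isOrthProj h.proj_mul_eq_zero).trace_le
  rw [trace_add, h.global_top.trace_eq, h.local_top.trace_eq] at this
  exact_mod_cast this

theorem spectralSplit (h : CovarianceDecomposition r₁ r₂ S Sg Sl Pg Pl) (h1 : 1 ≤ r₁)
    (h2 : 1 ≤ r₂) {δ : ℝ} (hδ : 0 < δ) (hgap : δ ≤ min (eig Sg r₁) (eig Sl r₂) -
      max (eig Sg (r₁ + 1)) (eig Sl (r₂ + 1))) :
    SpectralSplit S (Pg + Pl) (min (eig Sg r₁) (eig Sl r₂))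
      (max (eig Sg (r₁ + 1)) (eig Sl (r₂ + 1))) := by
  have hd := h.add_le
  have m1 := min_le_left (eig Sg r₁) (eig Sl r₂)
  have m2 := min_le_right (eig Sg r₁) (eig Sl r₂)
  have m3 := le_max_left (eig Sg (r₁ + 1)) (eig Sl (r₂ + 1))
  have m4 := le_max_right (eig Sg (r₁ + 1)) (eig Sl (r₂ + 1))
  have hlg : Sl * Sg = 0 := by
    simpa [show Sgᵀ = Sg from h.global_posSemidef.1, show Slᵀ = Sl from h.local_posSemidef.1] using
      congrArg Matrix.transpose h.orthogonal
  rw [h.sum_eq]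
  exact SpectralSplit.add
    ((eig_nonneg h.global_posSemidef (by omega) (by omega)).trans m3)
    (h.global_top.spectralSplit h.global_posSemidef.1 (by omega) (by linarith) m1 m3)
    (h.local_top.spectralSplit h.local_posSemidef.1 (by omega) (by linarith) m2 m4)
    h.global_posSemidef h.local_posSemidef h.orthogonal
    (mul_eq_zero_of_col_le h.orthogonal h.local_col) (mul_eq_zero_of_col_le hlg h.global_col)
    h.proj_mul_eq_zero

/-- The eigengap is at most the variance in some direction. -/
theorem exists_le_dotProduct_mulVec (h : CovarianceDecomposition r₁ r₂ S Sg Sl Pg Pl) (h1 : 1 ≤ r₁)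
    (h2 : 1 ≤ r₂) {δ : ℝ} (hgap : δ ≤ min (eig Sg r₁) (eig Sl r₂) -
      max (eig Sg (r₁ + 1)) (eig Sl (r₂ + 1))) :
    ∃ v : Fin d → ℝ, v ⬝ᵥ v = 1 ∧ δ ≤ v ⬝ᵥ (S *ᵥ v) := by
  have hd := h.add_le
  have m1 := min_le_left (eig Sg r₁) (eig Sl r₂)
  have m3 := (eig_nonneg h.global_posSemidef (by omega : 1 ≤ r₁ + 1) (by omega)).trans
    (le_max_left (eig Sg (r₁ + 1)) (eig Sl (r₂ + 1)))
  obtain ⟨U, hU, hAU, -⟩ := h.global_top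
  let q : Fin r₁ := ⟨r₁ - 1, by omega⟩
  have hv : (U.col q) ⬝ᵥ (U.col q) = 1 := by
    have := congrFun (congrFun hU q) q
    simpa [mul_apply, dotProduct] using this
  have he : Sg *ᵥ (U.col q) = eig Sg r₁ • U.col q := by
    ext a
    have := congrFun (congrFun hAU a) q
    rw [mul_diagonal, mul_apply] at this
    have hq : (q : ℕ) + 1 = r₁ := by simp only [q]; omega
    rw [hq] at this
    simpa [mulVec, dotProduct, mul_comm] using this
  refine ⟨U.col q, hv, ?_⟩
  have hl : 0 ≤ U.col q ⬝ᵥ (Sl *ᵥ U.col q) := by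
    simpa using h.local_posSemidef.dotProduct_mulVec_nonneg (U.col q)
  rw [h.sum_eq, add_mulVec, dotProduct_add, he, dotProduct_smul, hv, smul_eq_mul]
  linarith

end CovarianceDecomposition

variable {N : ℕ} {r₂ : Fin N → ℕ} {S Γ Sg Sl Pl : Fin N → Matrix (Fin d) (Fin d) ℝ}
  {U : Matrix (Fin d) (Fin r₁) ℝ} {V : (i : Fin N) → Matrix (Fin d) (Fin (r₂ i)) ℝ}

theorem objective_eq (S : Fin N → Matrix (Fin d) (Fin d) ℝ) (U : Matrix (Fin d) (Fin r₁) ℝ)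
    (V : (i : Fin N) → Matrix (Fin d) (Fin (r₂ i)) ℝ) :
    objective S U V = 1 / 2 * ∑ i, (S i * (proj U + proj (V i))).trace := by
  simp only [objective, proj, Matrix.mul_add, trace_add, ← Matrix.mul_assoc]
  congr 1
  refine Finset.sum_congr rfl fun i _ => ?_
  rw [Matrix.mul_assoc, trace_mul_comm, Matrix.mul_assoc (V i)ᵀ, trace_mul_comm (V i)ᵀ]

theorem Feasible.proj_mul_eq_zero (h : Feasible U V) (i : Fin N) : proj U * proj (V i) = 0 := by
  have h1 : Uᵀ * V i = 0 := by simpa using congrArg Matrix.transpose (h.2 i).2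
  rw [proj, proj, Matrix.mul_assoc, ← Matrix.mul_assoc Uᵀ, h1]; simp

theorem transpose_mul_eq_zero_of_proj {r s : ℕ} {U : Matrix (Fin d) (Fin r) ℝ}
    {V : Matrix (Fin d) (Fin s) ℝ} (hU : Uᵀ * U = 1) (hV : Vᵀ * V = 1)
    (h : proj U * proj V = 0) : Vᵀ * U = 0 := by
  have h1 : Uᵀ * V = 0 := by
    have : Uᵀ * (proj U * proj V) * V = Uᵀ * V := by
      simp only [proj, Matrix.mul_assoc, hV, Matrix.mul_one]
      rw [← Matrix.mul_assoc, hU, Matrix.one_mul]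
    rw [← this, h]; simp
  simpa using congrArg Matrix.transpose h1

/-- Settles large `ε` without any sample, so that `ε ≤ 4 d` may be assumed later. -/
theorem subspaceError_le_four_mul (hN : 0 < N)
    (hdec : ∀ i, CovarianceDecomposition r₁ (r₂ i) (Γ i) (Sg i) (Sl i) Pg (Pl i))
    (hUV : Feasible U V) : subspaceError Pg Pl U V ≤ 4 * d := by
  have hN' : (0 : ℝ) < N := by exact_mod_cast hN
  have key : ∀ (P Q : Matrix (Fin d) (Fin d) ℝ), IsOrthProj P → IsOrthProj Q →
      frobSq (P - Q) ≤ 2 * d := fun P Q hP hQ => by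
    have h := hQ.trace_mul_nonneg hP.posSemidef
    rw [frobSq_sub_proj hP hQ]
    linarith [hP.trace_le, hQ.trace_le]
  have h1 := key _ _ (isOrthProj_proj hUV.1) (hdec ⟨0, hN⟩).global_top.isOrthProj
  have h2 : ∑ i, frobSq (proj (V i) - Pl i) ≤ ∑ _i : Fin N, 2 * (d : ℝ) :=
    Finset.sum_le_sum fun i _ => key _ _ (isOrthProj_proj (hUV.2 i).1)
      (hdec i).local_top.isOrthProj
  have h3 := mul_le_mul_of_nonneg_left h2 (by positivity : 0 ≤ 1 / (N : ℝ))
  rw [Finset.sum_const, Finset.card_univ, Fintype.card_fin, nsmul_eq_mul, one_div,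
    inv_mul_cancel_left₀ hN'.ne', ← one_div] at h3
  unfold subspaceError
  linarith

/-- The error of a maximizer is controlled by the errors of the data covariance matrices. -/
theorem subspaceError_le {θ δ : ℝ} (hN : 0 < N) (h1 : 1 ≤ r₁) (h2 : ∀ i, 1 ≤ r₂ i)
    (hθ : 0 < θ) (hθ1 : θ < 1) (hδ : 0 < δ)
    (hdec : ∀ i, CovarianceDecomposition r₁ (r₂ i) (Γ i) (Sg i) (Sl i) Pg (Pl i))
    (hid : eig ((1 / (N : ℝ)) • ∑ i, Pl i) 1 ≤ 1 - θ)
    (hgap : ∀ i, δ ≤ min (eig (Sg i) r₁) (eig (Sl i) (r₂ i)) -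
      max (eig (Sg i) (r₁ + 1)) (eig (Sl i) (r₂ i + 1)))
    (hUV : IsOptimal S U V) :
    subspaceError Pg Pl U V ≤
      20 / (θ * δ ^ 2) * (1 / (N : ℝ) * ∑ i, frobSq (Γ i - S i)) := by
  obtain ⟨hf, hopt⟩ := hUV
  have hPg := (hdec ⟨0, hN⟩).global_top.isOrthProj
  have hPl := fun i => (hdec i).local_top.isOrthProj
  -- Optimality is used only here, against the true projections; the common `Pg` lets one `U'` serve
  -- all clients.
  have hsum : ∑ i, (S i * (Pg + Pl i)).trace ≤
      ∑ i, (S i * (proj U + proj (V i))).trace := by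
    obtain ⟨U', hU', -, hPU⟩ := (hdec ⟨0, hN⟩).global_top
    choose V' hV' _ hPV using fun i => (hdec i).local_top
    have hf' : Feasible U' V' := ⟨hU', fun i => ⟨hV' i, transpose_mul_eq_zero_of_proj hU' (hV' i)
      (by rw [← hPU, ← hPV]; exact (hdec i).proj_mul_eq_zero)⟩⟩
    have h := hopt U' V' hf'
    rw [objective_eq, objective_eq, ← hPU] at h
    simp only [← hPV] at h
    linarith
  have hR := fun i =>
    (isOrthProj_proj hf.1).add (isOrthProj_proj (hf.2 i).1) (hf.proj_mul_eq_zero i)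
  have htr : (proj U).trace = Pg.trace := by
    rw [trace_proj hf.1, (hdec ⟨0, hN⟩).global_top.trace_eq]
  have htr' : ∀ i, (proj (V i)).trace = (Pl i).trace := fun i => by
    rw [trace_proj (hf.2 i).1, (hdec i).local_top.trace_eq]
  have hD : ∀ i, δ / 4 * frobSq (Pg + Pl i - (proj U + proj (V i))) ≤
      1 / δ * frobSq (Γ i - S i) +
        (S i * (Pg + Pl i - (proj U + proj (V i)))).trace := fun i => by
    have hs := (hdec i).spectralSplit h1 (h2 i) hδ (hgap i)
    have e1 := hs.frobSq_le (hR i) (by rw [trace_add, trace_add, htr, htr' i])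
    have e2 := trace_mul_le_frobSq hδ (Γ i - S i) (Pg + Pl i - (proj U + proj (V i)))
      (by rw [transpose_sub, hs.isOrthProj.transpose_eq, (hR i).transpose_eq])
    have e3 := mul_le_mul_of_nonneg_right (hgap i)
      (frobSq_nonneg (Pg + Pl i - (proj U + proj (V i))))
    rw [Matrix.sub_mul, trace_sub] at e2
    linarith
  have hDsum := Finset.sum_le_sum fun i (_ : i ∈ Finset.univ) => hD i
  simp only [Finset.sum_add_distrib, ← Finset.mul_sum, Matrix.mul_sub (S _), trace_sub,
    Finset.sum_sub_distrib] at hDsum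
  have hherm : ((1 / (N : ℝ)) • ∑ i, Pl i).IsHermitian := by
    rw [IsHermitian, conjTranspose_eq_transpose_of_trivial, transpose_smul, transpose_sum]
    simp [fun i => (hPl i).transpose_eq]
  have hpsd : ((1 - θ) • 1 - (1 / (N : ℝ)) • ∑ i, Pl i).PosSemidef :=
    posSemidef_smul_one_sub hherm (dotProduct_mulVec_le_of_eigenvalues_le hherm
      fun k => (eigenvalues_le_eig_one hherm k).trans hid)
  have hmain := sum_frobSq_proj_le hθ hθ1 hN (isOrthProj_proj hf.1) hPg
    (fun i => isOrthProj_proj (hf.2 i).1) hPl hf.proj_mul_eq_zero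
    (fun i => (hdec i).proj_mul_eq_zero) htr htr' hpsd
  refine hmain.trans ?_
  have hle : ∑ i, frobSq (Pg + Pl i - (proj U + proj (V i))) ≤
      4 / δ ^ 2 * ∑ i, frobSq (Γ i - S i) := by
    have e : δ / 4 * ∑ i, frobSq (Pg + Pl i - (proj U + proj (V i))) ≤
        1 / δ * ∑ i, frobSq (Γ i - S i) := by linarith
    have := mul_le_mul_of_nonneg_left e (by positivity : 0 ≤ 4 / δ)
    calc _ = 4 / δ * (δ / 4 * ∑ i, frobSq (Pg + Pl i - (proj U + proj (V i)))) := by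
          field_simp
      _ ≤ _ := this
      _ = _ := by field_simp
  calc _ ≤ 5 / θ * (1 / (N : ℝ) * (4 / δ ^ 2 * ∑ i, frobSq (Γ i - S i))) := by gcongr
    _ = _ := by field_simp; ring

end Deterministic

/-! ### Exponential moments of squares of sub-Gaussian variables. -/

section SubGaussian

variable {E : Type*} [MeasurableSpace E] {ν : Measure E} {X : E → ℝ} {c : ℝ≥0}

/-- The integrand times the standard Gaussian density is `√2` times the density of variance `2`. -/
theorem lintegral_exp_sq_div_four_gaussianReal :
    ∫⁻ g, ENNReal.ofReal (Real.exp (g ^ 2 / 4)) ∂(gaussianReal 0 1) = ENNReal.ofReal (√2) := by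
  rw [gaussianReal_of_var_ne_zero 0 one_ne_zero, lintegral_withDensity_eq_lintegral_mul _
    (measurable_gaussianPDF 0 1) (by fun_prop)]
  have h : ∀ g : ℝ, (gaussianPDF 0 1 * fun g => ENNReal.ofReal (Real.exp (g ^ 2 / 4))) g =
      ENNReal.ofReal (√2) * ENNReal.ofReal (gaussianPDFReal 0 2 g) := fun g => by
    rw [Pi.mul_apply, gaussianPDF, ← ENNReal.ofReal_mul (gaussianPDFReal_nonneg _ _ _),
      ← ENNReal.ofReal_mul (Real.sqrt_nonneg _)]
    congr 1
    simp only [gaussianPDFReal, NNReal.coe_one, NNReal.coe_ofNat, sub_zero, mul_one]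
    rw [mul_assoc, ← Real.exp_add, mul_right_comm 2 Real.pi 2, mul_assoc 2 2 Real.pi,
      Real.sqrt_mul zero_le_two (2 * Real.pi), mul_inv,
      ← mul_assoc, ← mul_assoc, mul_inv_cancel₀ (by positivity), one_mul]
    congr 2
    ring
  simp_rw [h]
  rw [lintegral_const_mul _ (by fun_prop), lintegral_gaussianPDFReal_eq_one 0 two_ne_zero, mul_one]

/-- Gaussian linearization: `exp (X² / (4 c))` is the mean of `exp (s X g)` over a standard Gaussian
`g` with `s² = 1 / (2 c)`. After Tonelli the sub-Gaussian bound leaves `exp (g² / 4)`. Lower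
integrals avoid assuming the integrability to be proved. -/
theorem lintegral_exp_sq_le [IsProbabilityMeasure ν] (hX : HasSubgaussianMGF X c ν)
    (hXm : Measurable X) (hc : 0 < c) :
    ∫⁻ y, ENNReal.ofReal (Real.exp (X y ^ 2 / (4 * c))) ∂ν ≤ ENNReal.ofReal (√2) := by
  have hc' : (0 : ℝ) < c := by exact_mod_cast hc
  set s : ℝ := √(1 / (2 * c)) with hs
  have hs2 : s ^ 2 = 1 / (2 * c) := Real.sq_sqrt (by positivity)
  have h1 : ∀ y, ENNReal.ofReal (Real.exp (X y ^ 2 / (4 * c))) =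
      ∫⁻ g, ENNReal.ofReal (Real.exp (s * X y * g)) ∂(gaussianReal 0 1) := fun y => by
    rw [← ofReal_integral_eq_lintegral_ofReal (integrable_exp_mul_gaussianReal _)
      (ae_of_all _ fun _ => (Real.exp_pos _).le)]
    have := congrFun (mgf_id_gaussianReal (μ := 0) (v := 1)) (s * X y)
    simp only [mgf, id] at this
    rw [this]
    congr 2
    simp only [NNReal.coe_one, zero_mul, zero_add, one_mul, mul_pow, hs2]
    field_simp
    norm_num
  simp_rw [h1]
  rw [lintegral_lintegral_swap (by fun_prop), ← lintegral_exp_sq_div_four_gaussianReal]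
  refine lintegral_mono fun g => ?_
  have h2 := hX.integrable_exp_mul (s * g)
  have h3 := hX.mgf_le (s * g)
  have h4 : ∀ y, s * X y * g = s * g * X y := fun y => by ring
  simp_rw [h4]
  rw [← ofReal_integral_eq_lintegral_ofReal h2 (ae_of_all _ fun _ => (Real.exp_pos _).le)]
  refine ENNReal.ofReal_le_ofReal (h3.trans_eq ?_)
  rw [mul_pow, hs2]
  congr 1
  field_simp
  ring

theorem integrable_exp_sq [IsProbabilityMeasure ν] (hX : HasSubgaussianMGF X c ν)
    (hXm : Measurable X) (hc : 0 < c) :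
    Integrable (fun y => Real.exp (X y ^ 2 / (4 * c))) ν := by
  refine ⟨by fun_prop, ?_⟩
  rw [hasFiniteIntegral_iff_ofReal (ae_of_all _ fun _ => (Real.exp_pos _).le)]
  exact (lintegral_exp_sq_le hX hXm hc).trans_lt ENNReal.ofReal_lt_top

theorem integral_exp_sq_le [IsProbabilityMeasure ν] (hX : HasSubgaussianMGF X c ν)
    (hXm : Measurable X) (hc : 0 < c) :
    ∫ y, Real.exp (X y ^ 2 / (4 * c)) ∂ν ≤ 3 / 2 := by
  rw [integral_eq_lintegral_of_nonneg_ae (ae_of_all _ fun _ => (Real.exp_pos _).le)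
    (by fun_prop)]
  have h := ENNReal.toReal_mono ENNReal.ofReal_ne_top (lintegral_exp_sq_le hX hXm hc)
  rw [ENNReal.toReal_ofReal (Real.sqrt_nonneg _)] at h
  exact h.trans (Real.sqrt_le_iff.2 ⟨by norm_num, by norm_num⟩)

theorem integrable_sq_of_hasSubgaussianMGF (hX : HasSubgaussianMGF X c ν) :
    Integrable (fun y => X y ^ 2) ν := (hX.memLp 2).integrable_sq

/-- The second moment of a sub-Gaussian variable with parameter `c` is at most `2 c`. -/
theorem integral_sq_le [IsProbabilityMeasure ν] (hX : HasSubgaussianMGF X c ν)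
    (hXm : Measurable X) : ∫ y, X y ^ 2 ∂ν ≤ 2 * c := by
  rcases eq_or_ne c 0 with rfl | hc
  · have h := hX.ae_eq_zero_of_hasSubgaussianMGF_zero
    rw [integral_eq_zero_of_ae (h.mono fun y hy => by simp [hy])]
    simp
  have hc0 : 0 < c := pos_iff_ne_zero.2 hc
  have hc' : (0 : ℝ) < c := by exact_mod_cast hc0
  have h1 : ∫ y, (1 + X y ^ 2 / (4 * c)) ∂ν ≤ 3 / 2 :=
    (integral_mono ((integrable_const 1).add ((integrable_sq_of_hasSubgaussianMGF hX).div_const _))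
      (integrable_exp_sq hX hXm hc0) fun y => by
        have := Real.add_one_le_exp (X y ^ 2 / (4 * c))
        rw [Pi.add_apply]; linarith).trans (integral_exp_sq_le hX hXm hc0)
  rw [integral_add (integrable_const 1) ((integrable_sq_of_hasSubgaussianMGF hX).div_const _),
    integral_div] at h1
  simp only [integral_const, probReal_univ, smul_eq_mul, mul_one] at h1
  have h2 : (∫ y, X y ^ 2 ∂ν) / (4 * c) ≤ 1 / 2 := by linarith
  rw [div_le_iff₀ (by positivity)] at h2
  linarith

/-- From `1 + t X ≤ exp (t X)`, the function `exp (c t² / 2) - 1 - t m` is nonnegative and vanishes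
at `0`, so its derivative `-m` there is zero. Centering makes covariances second moments, which
`sampleCov` estimates. -/
theorem integral_eq_zero_of_hasSubgaussianMGF [IsProbabilityMeasure ν]
    (hX : HasSubgaussianMGF X c ν) : ∫ y, X y ∂ν = 0 := by
  set m := ∫ y, X y ∂ν with hm
  have h1 : ∀ t : ℝ, 0 ≤ Real.exp (c * t ^ 2 / 2) - 1 - t * m := fun t => by
    have h : ∫ y, (t * X y + 1) ∂ν ≤ mgf X ν t :=
      integral_mono ((hX.integrable.const_mul t).add (integrable_const 1))
        (hX.integrable_exp_mul t) fun y => Real.add_one_le_exp _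
    rw [integral_add (hX.integrable.const_mul t) (integrable_const 1), integral_const_mul] at h
    simp only [integral_const, probReal_univ, smul_eq_mul, mul_one] at h
    linarith [hX.mgf_le t]
  have h2 : HasDerivAt (fun t : ℝ => Real.exp (c * t ^ 2 / 2) - 1 - t * m) (-m) 0 := by
    have h := (((((hasDerivAt_id (0 : ℝ)).pow 2).const_mul (c : ℝ)).div_const 2).exp.sub_const
      1).sub ((hasDerivAt_id (0 : ℝ)).mul_const m)
    convert! h using 1
    simp
  have h3 : IsLocalMin (fun t : ℝ => Real.exp (c * t ^ 2 / 2) - 1 - t * m) 0 :=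
    Filter.Eventually.of_forall fun t => by simpa using h1 t
  have := h3.hasDerivAt_eq_zero h2
  linarith

theorem exp_le_one_add_add_sq (y : ℝ) : Real.exp y ≤ 1 + y + y ^ 2 * Real.exp |y| := by
  have h1 : Real.exp y - 1 ≤ y * Real.exp y := by
    have h := mul_le_mul_of_nonneg_left (Real.add_one_le_exp (-y)) (Real.exp_pos y).le
    rw [← Real.exp_add, add_neg_cancel, Real.exp_zero] at h
    linarith
  rcases le_total 0 y with hy | hy
  · rw [abs_of_nonneg hy]
    nlinarith
  · rw [abs_of_nonpos hy]
    have h2 := Real.add_one_le_exp y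
    have h3 : 1 ≤ Real.exp (-y) := Real.one_le_exp (by linarith)
    nlinarith [sq_nonneg y]

/-- One factor `exp (w / 2)` pays for `w²` and another for `exp |t w|`, so the remainder needs only
the moment of `exp w`. Its bound `3 / 2` then gives the constant `12 = 8 * 3 / 2` in
`mgf_centeredSq_le`. -/
theorem exp_mul_le {t w : ℝ} (hw : 0 ≤ w) (ht : |t| ≤ 1 / 2) :
    Real.exp (t * w) ≤ 1 + t * w + 8 * t ^ 2 * Real.exp w := by
  refine (exp_le_one_add_add_sq (t * w)).trans ?_
  have h1 : Real.exp |t * w| ≤ Real.exp (w / 2) := by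
    rw [Real.exp_le_exp, abs_mul, abs_of_nonneg hw]
    nlinarith
  have h2 : w ^ 2 ≤ 8 * Real.exp (w / 2) := by
    have := Real.quadratic_le_exp_of_nonneg (by linarith : 0 ≤ w / 2)
    nlinarith
  have h3 : Real.exp w = Real.exp (w / 2) * Real.exp (w / 2) := by
    rw [← Real.exp_add]; ring_nf
  have h4 : (t * w) ^ 2 * Real.exp |t * w| ≤ t ^ 2 * (8 * Real.exp (w / 2)) * Real.exp (w / 2) := by
    rw [mul_pow]
    gcongr
  rw [h3]
  linarith

/-- The normalized centered square of a sub-Gaussian variable. -/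
noncomputable def centeredSq (ν : Measure E) (X : E → ℝ) (c : ℝ≥0) (y : E) : ℝ :=
  X y ^ 2 / (4 * c) - ∫ z, X z ^ 2 / (4 * c) ∂ν

theorem integrable_exp_mul_sq [IsProbabilityMeasure ν] (hX : HasSubgaussianMGF X c ν)
    (hXm : Measurable X) (hc : 0 < c) {t : ℝ} (ht : |t| ≤ 1 / 2) :
    Integrable (fun y => Real.exp (t * (X y ^ 2 / (4 * c)))) ν := by
  refine (integrable_exp_sq hX hXm hc).mono (by fun_prop) (ae_of_all _ fun y => ?_)
  rw [Real.norm_eq_abs, Real.norm_eq_abs, Real.abs_exp, Real.abs_exp, Real.exp_le_exp]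
  have h1 : 0 ≤ X y ^ 2 / (4 * (c : ℝ)) := by positivity
  nlinarith [le_abs_self t]

theorem integrable_exp_mul_centeredSq [IsProbabilityMeasure ν] (hX : HasSubgaussianMGF X c ν)
    (hXm : Measurable X) (hc : 0 < c) {t : ℝ} (ht : |t| ≤ 1 / 2) :
    Integrable (fun y => Real.exp (t * centeredSq ν X c y)) ν := by
  simp only [centeredSq, mul_sub, Real.exp_sub]
  exact (integrable_exp_mul_sq hX hXm hc ht).div_const _

theorem mgf_centeredSq_le [IsProbabilityMeasure ν] (hX : HasSubgaussianMGF X c ν)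
    (hXm : Measurable X) (hc : 0 < c) {t : ℝ} (ht : |t| ≤ 1 / 2) :
    mgf (centeredSq ν X c) ν t ≤ Real.exp (12 * t ^ 2) := by
  set m := ∫ z, X z ^ 2 / (4 * c) ∂ν with hm
  have i1 : Integrable (fun y => X y ^ 2 / (4 * (c : ℝ))) ν :=
    (integrable_sq_of_hasSubgaussianMGF hX).div_const _
  have i2 := integrable_exp_sq hX hXm hc
  have h1 : ∫ y, Real.exp (t * (X y ^ 2 / (4 * c))) ∂ν ≤ 1 + t * m + 8 * t ^ 2 * (3 / 2) := by
    have h := integral_mono (integrable_exp_mul_sq hX hXm hc ht)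
      (((integrable_const (1 : ℝ)).add (i1.const_mul t)).add (i2.const_mul (8 * t ^ 2)))
      fun y => exp_mul_le (by positivity) ht
    refine h.trans ?_
    rw [integral_add' ((integrable_const (1 : ℝ)).add (i1.const_mul t)) (i2.const_mul _),
      integral_add' (integrable_const (1 : ℝ)) (i1.const_mul t), integral_const_mul,
      integral_const_mul]
    simp only [integral_const, probReal_univ, smul_eq_mul, mul_one]
    gcongr
    exact integral_exp_sq_le hX hXm hc
  have h2 : mgf (centeredSq ν X c) ν t =
      (∫ y, Real.exp (t * (X y ^ 2 / (4 * c))) ∂ν) / Real.exp (t * m) := by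
    simp only [mgf, centeredSq, mul_sub, Real.exp_sub]
    rw [integral_div]
  rw [h2, div_le_iff₀ (Real.exp_pos _), ← Real.exp_add]
  refine h1.trans ?_
  have := Real.add_one_le_exp (12 * t ^ 2 + t * m)
  linarith

variable {Ω : Type*} [MeasurableSpace Ω] {P : Measure Ω}

/-- Chernoff's bound at `t = s / 24`, the minimizer of `12 t² - t s`; the condition `s ≤ 12` is `t ≤
1 / 2`. -/
theorem measureReal_sum_ge_le [IsProbabilityMeasure P] {n : ℕ} {Y : Fin n → Ω → E}
    (hY : ∀ j, HasLaw (Y j) ν P) (hind : iIndepFun Y P) {f : E → ℝ} (hf : Measurable f)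
    (hint : ∀ t : ℝ, 0 ≤ t → t ≤ 1 / 2 → Integrable (fun y => Real.exp (t * f y)) ν)
    (hmgf : ∀ t : ℝ, 0 ≤ t → t ≤ 1 / 2 → mgf f ν t ≤ Real.exp (12 * t ^ 2))
    {s : ℝ} (hs : 0 ≤ s) (hs' : s ≤ 12) :
    P.real {ω | n * s ≤ ∑ j, f (Y j ω)} ≤ Real.exp (-(n * s ^ 2 / 48)) := by
  have ht0 : 0 ≤ s / 24 := by positivity
  have ht1 : s / 24 ≤ 1 / 2 := by linarith
  have hm : ∀ j, AEMeasurable (f ∘ Y j) P := fun j => hf.comp_aemeasurable (hY j).aemeasurable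
  have hind' : iIndepFun (fun j => f ∘ Y j) P := hind.comp (fun _ => f) fun _ => hf
  have hi : ∀ j, Integrable (fun ω => Real.exp (s / 24 * (f ∘ Y j) ω)) P := fun j => by
    have h := hint _ ht0 ht1
    rw [← (hY j).map_eq] at h
    exact h.comp_aemeasurable (hY j).aemeasurable
  have hmg : ∀ j, mgf (f ∘ Y j) P (s / 24) = mgf f ν (s / 24) := fun j => by
    rw [← (hY j).map_eq, mgf_map (hY j).aemeasurable (by fun_prop)]
  have h := measure_ge_le_exp_mul_mgf (μ := P) (X := ∑ j, f ∘ Y j) (n * s) ht0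
    (by
      -- For a probability measure, integrability of the exponential of the sum is equivalent to
      -- positivity of its moment generating function, which factors by independence.
      rw [← mgf_pos_iff, hind'.mgf_sum₀ hm]
      exact Finset.prod_pos fun j _ => mgf_pos (hi j))
  rw [hind'.mgf_sum₀ hm] at h
  simp only [hmg, Finset.prod_const, Finset.card_univ, Fintype.card_fin, Finset.sum_apply,
    Function.comp_apply] at h
  refine h.trans ?_
  have h2 := pow_le_pow_left₀ mgf_nonneg (hmgf _ ht0 ht1) n
  refine (mul_le_mul_of_nonneg_left h2 (Real.exp_pos _).le).trans_eq ?_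
  rw [← Real.exp_nat_mul, ← Real.exp_add]
  congr 1
  ring

theorem measureReal_abs_sum_centeredSq_ge_le [IsProbabilityMeasure ν] [IsProbabilityMeasure P]
    {n : ℕ} {Y : Fin n → Ω → E} (hY : ∀ j, HasLaw (Y j) ν P) (hind : iIndepFun Y P)
    (hX : HasSubgaussianMGF X c ν) (hXm : Measurable X) (hc : 0 < c)
    {s : ℝ} (hs : 0 ≤ s) (hs' : s ≤ 12) :
    P.real {ω | n * s ≤ |∑ j, centeredSq ν X c (Y j ω)|} ≤
      2 * Real.exp (-(n * s ^ 2 / 48)) := by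
  have hm : Measurable (centeredSq ν X c) := by unfold centeredSq; fun_prop
  have ha : ∀ t : ℝ, 0 ≤ t → t ≤ 1 / 2 → |t| ≤ 1 / 2 := fun t h0 h1 => by rwa [abs_of_nonneg h0]
  have ha' : ∀ t : ℝ, 0 ≤ t → t ≤ 1 / 2 → |-t| ≤ 1 / 2 := fun t h0 h1 => by
    rwa [abs_neg, abs_of_nonneg h0]
  have h1 := measureReal_sum_ge_le hY hind hm
    (fun t h0 h1 => integrable_exp_mul_centeredSq hX hXm hc (ha t h0 h1))
    (fun t h0 h1 => mgf_centeredSq_le hX hXm hc (ha t h0 h1)) hs hs'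
  have h2 := measureReal_sum_ge_le hY hind hm.neg
    (fun t h0 h1 => by
      simpa using integrable_exp_mul_centeredSq hX hXm hc (ha' t h0 h1))
    (fun t h0 h1 => by
      rw [mgf_neg]
      simpa using mgf_centeredSq_le hX hXm hc (ha' t h0 h1)) hs hs'
  have hsub : {ω | n * s ≤ |∑ j, centeredSq ν X c (Y j ω)|} ⊆
      {ω | n * s ≤ ∑ j, centeredSq ν X c (Y j ω)} ∪
        {ω | n * s ≤ ∑ j, (-centeredSq ν X c) (Y j ω)} := fun ω hω => by
    rcases le_abs.1 (show n * s ≤ |_| from hω) with h | h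
    · exact Or.inl h
    · right
      simpa [Finset.sum_neg_distrib] using h
  refine (measureReal_mono hsub).trans ((measureReal_union_le _ _).trans ?_)
  linarith

end SubGaussian

/-! ### Nets and concentration of the sample covariance. -/

section Concentration

variable {d : ℕ}

/-- A `1/2`-separated set of unit vectors of largest cardinality is a net. Doubling it gives a
`1`-separated set in the ball of radius `2`, as the packing bound `5 ^ d` requires. -/
theorem exists_half_net (d : ℕ) : ∃ s : Finset (EuclideanSpace ℝ (Fin d)), s.card ≤ 5 ^ d ∧
    (∀ v ∈ s, ‖v‖ = 1) ∧ ∀ x : EuclideanSpace ℝ (Fin d), ‖x‖ = 1 → ∃ v ∈ s, ‖x - v‖ ≤ 1 / 2 := by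
  classical
  let T : Set ℕ := {n | ∃ s : Finset (EuclideanSpace ℝ (Fin d)), s.card = n ∧
    (∀ v ∈ s, ‖v‖ = 1) ∧ ∀ v ∈ s, ∀ w ∈ s, v ≠ w → 1 / 2 ≤ ‖v - w‖}
  have hbd : ∀ n ∈ T, n ≤ 5 ^ d := by
    rintro n ⟨s, rfl, h1, h2⟩
    have hinj : Function.Injective fun v : EuclideanSpace ℝ (Fin d) => (2 : ℝ) • v :=
      smul_right_injective _ two_ne_zero
    have h := Besicovitch.card_le_of_separated (s.image fun v => (2 : ℝ) • v)
      (by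
        intro c hc
        obtain ⟨v, hv, rfl⟩ := Finset.mem_image.1 hc
        simp [norm_smul, h1 v hv])
      (by
        intro c hc e he hce
        obtain ⟨v, hv, rfl⟩ := Finset.mem_image.1 hc
        obtain ⟨w, hw, rfl⟩ := Finset.mem_image.1 he
        have := h2 v hv w hw fun h => hce (by rw [h])
        rw [← smul_sub, norm_smul, Real.norm_ofNat]
        linarith)
    rwa [Finset.card_image_of_injective _ hinj, finrank_euclideanSpace_fin] at h
  have hne : T.Nonempty := ⟨0, ∅, by simp⟩
  have hba : BddAbove T := ⟨5 ^ d, hbd⟩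
  obtain ⟨s, hcard, h1, h2⟩ := Nat.sSup_mem hne hba
  refine ⟨s, hcard ▸ hbd _ (Nat.sSup_mem hne hba), h1, fun x hx => ?_⟩
  by_contra! hfar
  have hxs : x ∉ s := fun h => by
    have := hfar x h
    rw [sub_self, norm_zero] at this
    norm_num at this
  have hmem : s.card + 1 ∈ T := by
    refine ⟨insert x s, Finset.card_insert_of_notMem hxs, ?_, ?_⟩
    · simpa [hx] using h1
    · intro v hv w hw hvw
      rcases Finset.mem_insert.1 hv with rfl | hv' <;> rcases Finset.mem_insert.1 hw with rfl | hw'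
      · exact absurd rfl hvw
      · exact (hfar w hw').le
      · rw [norm_sub_rev]; exact (hfar v hv').le
      · exact h2 v hv' w hw' hvw
  have := le_csSup hba hmem
  omega

theorem abs_dotProduct_mulVec_le {A : Matrix (Fin d) (Fin d) ℝ} (hA : A.IsHermitian) {b : ℝ}
    (h : ∀ k, |hA.eigenvalues k| ≤ b) (x : Fin d → ℝ) : |x ⬝ᵥ (A *ᵥ x)| ≤ b * (x ⬝ᵥ x) := by
  rw [dotProduct_mulVec_eq_sum hA, dotProduct_self_eq_sum hA, Finset.mul_sum]
  refine (Finset.abs_sum_le_sum_abs _ _).trans (Finset.sum_le_sum fun k _ => ?_)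
  rw [abs_mul, abs_of_nonneg (sq_nonneg (_ : ℝ))]
  exact mul_le_mul_of_nonneg_right (h k) (sq_nonneg _)

theorem frobSq_eq_sum_eigenvalues {A : Matrix (Fin d) (Fin d) ℝ} (hA : A.IsHermitian) :
    frobSq A = ∑ k, hA.eigenvalues k ^ 2 := by
  set V : Matrix (Fin d) (Fin d) ℝ := ↑hA.eigenvectorUnitary
  have h : A = V * diagonal hA.eigenvalues * Vᵀ := by
    simpa [Unitary.conjStarAlgAut_apply, star_eq_conjTranspose,
      conjTranspose_eq_transpose_of_trivial, Function.comp_def] using hA.spectral_theorem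
  have hV : Vᵀ * V = 1 := by
    simpa [star_eq_conjTranspose, conjTranspose_eq_transpose_of_trivial] using
      Unitary.coe_star_mul_self hA.eigenvectorUnitary
  have h2 : A * Aᵀ = V * (diagonal hA.eigenvalues * diagonal hA.eigenvalues * Vᵀ) := by
    conv_lhs => rw [show Aᵀ = A from hA, h]
    simp only [Matrix.mul_assoc]
    rw [← Matrix.mul_assoc Vᵀ V, hV, Matrix.one_mul]
  rw [frobSq_eq_trace, h2, trace_mul_comm, Matrix.mul_assoc, hV, Matrix.mul_one,
    diagonal_mul_diagonal, trace_diagonal]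
  simp [sq]

theorem dotProduct_self_eq_norm_sq (v : EuclideanSpace ℝ (Fin d)) :
    (v : Fin d → ℝ) ⬝ᵥ v = ‖v‖ ^ 2 := by
  rw [EuclideanSpace.real_norm_sq_eq]
  simp [dotProduct, sq]

theorem inner_eq_dotProduct (v w : EuclideanSpace ℝ (Fin d)) :
    inner ℝ v w = (v : Fin d → ℝ) ⬝ᵥ w := by
  simp [PiLp.inner_apply, dotProduct, mul_comm]

/-- A bound on the quadratic form on a `1/2`-net bounds the Frobenius norm. -/
theorem frobSq_le_of_net {A : Matrix (Fin d) (Fin d) ℝ} (hA : A.IsHermitian)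
    {s : Finset (EuclideanSpace ℝ (Fin d))} (hs : ∀ v ∈ s, ‖v‖ = 1)
    (hnet : ∀ x : EuclideanSpace ℝ (Fin d), ‖x‖ = 1 → ∃ v ∈ s, ‖x - v‖ ≤ 1 / 2) {b : ℝ}
    (hb : ∀ v ∈ s, |(v : Fin d → ℝ) ⬝ᵥ (A *ᵥ v)| ≤ b) : frobSq A ≤ d * (2 * b) ^ 2 := by
  rw [frobSq_eq_sum_eigenvalues hA]
  suffices h : ∀ k, |hA.eigenvalues k| ≤ 2 * b by
    have : ∑ k, hA.eigenvalues k ^ 2 ≤ ∑ _k : Fin d, (2 * b) ^ 2 :=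
      Finset.sum_le_sum fun k _ => sq_le_sq' (neg_le_of_abs_le (h k)) (le_of_abs_le (h k))
    simpa using this
  rcases isEmpty_or_nonempty (Fin d) with he | he
  · exact fun k => he.elim k
  obtain ⟨k₀, hk₀⟩ := Finite.exists_max fun k => |hA.eigenvalues k|
  refine fun k => (hk₀ k).trans ?_
  set lam := hA.eigenvalues k₀
  set x := hA.eigenvectorBasis k₀
  have hx : ‖x‖ = 1 := hA.eigenvectorBasis.orthonormal.1 k₀
  obtain ⟨v, hv, hxv⟩ := hnet x hx
  have hAx : A *ᵥ x = lam • (x : Fin d → ℝ) := hA.mulVec_eigenvectorBasis k₀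
  set y : EuclideanSpace ℝ (Fin d) := v - x with hy
  have hvy : (v : Fin d → ℝ) = x + y := by simp [hy]
  have hsymm : (x : Fin d → ℝ) ⬝ᵥ (A *ᵥ y) = lam * ((x : Fin d → ℝ) ⬝ᵥ y) := by
    rw [dotProduct_mulVec, ← mulVec_transpose, show Aᵀ = A from hA, hAx, smul_dotProduct,
      smul_eq_mul]
  have hyx : (y : Fin d → ℝ) ⬝ᵥ x = (x : Fin d → ℝ) ⬝ᵥ y := dotProduct_comm _ _
  have e0 : (x : Fin d → ℝ) ⬝ᵥ x = 1 := by rw [dotProduct_self_eq_norm_sq, hx, one_pow]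
  -- Both `x` and `v = x + y` are unit vectors, so moving from `x` to `v` costs only second order in
  -- `‖y‖`. With `‖y‖² ≤ 1 / 4` this leaves `|lam| / 2 ≤ b`.
  have e1 : 2 * ((x : Fin d → ℝ) ⬝ᵥ y) = -‖y‖ ^ 2 := by
    have h := dotProduct_self_eq_norm_sq v
    rw [hs v hv, hvy, add_dotProduct, dotProduct_add, dotProduct_add, e0,
      dotProduct_self_eq_norm_sq, hyx] at h
    linarith
  have e2 : (v : Fin d → ℝ) ⬝ᵥ (A *ᵥ v) =
      lam * (1 - ‖y‖ ^ 2) + (y : Fin d → ℝ) ⬝ᵥ (A *ᵥ y) := by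
    rw [hvy, mulVec_add, add_dotProduct, dotProduct_add, dotProduct_add, hsymm, hAx,
      dotProduct_smul, dotProduct_smul, hyx, e0, smul_eq_mul, smul_eq_mul]
    linear_combination lam * e1
  have e3 := abs_dotProduct_mulVec_le hA hk₀ y
  rw [dotProduct_self_eq_norm_sq] at e3
  have e4 : ‖y‖ ^ 2 ≤ 1 / 4 := by
    have : ‖y‖ ≤ 1 / 2 := by rwa [hy, norm_sub_rev]
    nlinarith [norm_nonneg y]
  have e5 := hb v hv
  rw [e2] at e5
  have e6 : |lam| * (1 - ‖y‖ ^ 2) ≤ b + |lam| * ‖y‖ ^ 2 := by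
    rw [← abs_of_nonneg (by linarith : 0 ≤ 1 - ‖y‖ ^ 2), ← abs_mul]
    calc |lam * (1 - ‖y‖ ^ 2)| = |(lam * (1 - ‖y‖ ^ 2) + (y : Fin d → ℝ) ⬝ᵥ (A *ᵥ y)) -
          (y : Fin d → ℝ) ⬝ᵥ (A *ᵥ y)| := by rw [add_sub_cancel_right]
      _ ≤ _ := abs_sub _ _
      _ ≤ _ := add_le_add e5 e3
  nlinarith [abs_nonneg lam]

variable {σ : ℝ≥0} {ν : Measure (EuclideanSpace ℝ (Fin d))}

theorem dotProduct_covMatrix_mulVec [IsProbabilityMeasure ν] (hν : IsSubGaussian σ ν)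
    {v : EuclideanSpace ℝ (Fin d)} (hv : ‖v‖ = 1) :
    (v : Fin d → ℝ) ⬝ᵥ (covMatrix ν *ᵥ v) = ∫ y, (inner ℝ v y : ℝ) ^ 2 ∂ν := by
  have hL : ∀ a, MemLp (fun y : EuclideanSpace ℝ (Fin d) => v a * y a) 2 ν := fun a => by
    have h := (hν (EuclideanSpace.single a 1) (by simp)).memLp 2
    simp only [EuclideanSpace.inner_single_left, map_one, one_mul] at h
    exact MemLp.const_mul (by exact_mod_cast h) (v a)
  have h1 : (fun y : EuclideanSpace ℝ (Fin d) => (inner ℝ v y : ℝ)) =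
      fun y => ∑ a, v a * y a := by
    ext y; rw [inner_eq_dotProduct]; rfl
  have h2 := covariance_fun_sum_fun_sum (X := fun a (y : EuclideanSpace ℝ (Fin d)) => v a * y a)
    (Y := fun a (y : EuclideanSpace ℝ (Fin d)) => v a * y a) (μ := ν) hL hL
  have hm : AEMeasurable (fun y : EuclideanSpace ℝ (Fin d) => (inner ℝ v y : ℝ)) ν := by fun_prop
  rw [← variance_of_integral_eq_zero hm (integral_eq_zero_of_hasSubgaussianMGF (hν v hv)),
    ← covariance_self hm, h1, h2]
  simp only [covariance_const_mul_left, covariance_const_mul_right, dotProduct, mulVec, covMatrix,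
    of_apply, Finset.mul_sum]
  exact Finset.sum_congr rfl fun a _ => Finset.sum_congr rfl fun b _ => by ring

theorem dotProduct_sampleCov_mulVec {n : ℕ} (y : Fin n → EuclideanSpace ℝ (Fin d))
    (v : EuclideanSpace ℝ (Fin d)) :
    (v : Fin d → ℝ) ⬝ᵥ (sampleCov y *ᵥ v) = 1 / (n : ℝ) * ∑ j, (inner ℝ v (y j) : ℝ) ^ 2 := by
  simp only [sampleCov]
  rw [smul_mulVec, dotProduct_smul, smul_eq_mul, ← mulVec_mulVec, dotProduct_mulVec,
    ← mulVec_transpose]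
  congr 1
  refine Finset.sum_congr rfl fun j _ => ?_
  rw [sq, inner_eq_dotProduct, dotProduct_comm]
  rfl

theorem isHermitian_covMatrix_sub_sampleCov {n : ℕ} (y : Fin n → EuclideanSpace ℝ (Fin d)) :
    (covMatrix ν - sampleCov y).IsHermitian := by
  refine IsHermitian.sub ?_ ?_
  · ext a b
    simp [covMatrix, covariance_comm]
  · simp only [sampleCov]
    rw [IsHermitian, conjTranspose_eq_transpose_of_trivial, transpose_smul, transpose_mul,
      transpose_transpose]

theorem dotProduct_covMatrix_sub_sampleCov_mulVec [IsProbabilityMeasure ν]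
    (hν : IsSubGaussian σ ν) (hσ : 0 < σ) {n : ℕ} (hn : 0 < n)
    (y : Fin n → EuclideanSpace ℝ (Fin d)) {v : EuclideanSpace ℝ (Fin d)} (hv : ‖v‖ = 1) :
    (v : Fin d → ℝ) ⬝ᵥ ((covMatrix ν - sampleCov y) *ᵥ v) =
      -(4 * (σ : ℝ) ^ 2 / n * ∑ j, centeredSq ν (fun z => inner ℝ v z) (σ ^ 2) (y j)) := by
  have hn' : (0 : ℝ) < n := by exact_mod_cast hn
  have hσ' : (0 : ℝ) < σ := by exact_mod_cast hσ
  rw [sub_mulVec, dotProduct_sub, dotProduct_covMatrix_mulVec hν hv, dotProduct_sampleCov_mulVec]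
  simp only [centeredSq, Finset.sum_sub_distrib, integral_div, ← Finset.sum_div, Finset.sum_const,
    Finset.card_univ, Fintype.card_fin, nsmul_eq_mul, NNReal.coe_pow]
  field_simp
  ring

variable {Ω : Type*} [MeasurableSpace Ω] {P : Measure Ω}

/-- Concentration of the data covariance matrix of sub-Gaussian observations. -/
theorem measureReal_lt_frobSq_le [IsProbabilityMeasure ν] [IsProbabilityMeasure P]
    (hν : IsSubGaussian σ ν) (hσ : 0 < σ) {n : ℕ} (hn : 0 < n)
    {Y : Fin n → Ω → EuclideanSpace ℝ (Fin d)} (hY : ∀ j, HasLaw (Y j) ν P)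
    (hind : iIndepFun Y P) {u : ℝ} (hu : 0 ≤ u) (hun : d + u ≤ n) :
    P.real {ω | 6144 * ((σ : ℝ) ^ 4 * d * (d + u)) / n <
      frobSq (covMatrix ν - sampleCov fun j => Y j ω)} ≤ 2 * Real.exp (-u) := by
  have hn' : (0 : ℝ) < n := by exact_mod_cast hn
  obtain ⟨T, hcard, hT, hnet⟩ := exists_half_net d
  -- This makes `n s² / 48 = 2 (d + u)`, which absorbs the net size `5 ^ d ≤ exp (2 d)`; and `d + u
  -- ≤ n` ensures `s ≤ 12`. The constant is `6144 = 64 * 96`.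
  set s : ℝ := √(96 * (d + u) / n) with hs
  have hs2 : s ^ 2 = 96 * (d + u) / n := Real.sq_sqrt (by positivity)
  have hs0 : 0 ≤ s := Real.sqrt_nonneg _
  have hs12 : s ≤ 12 := by
    refine Real.sqrt_le_iff.2 ⟨by norm_num, ?_⟩
    rw [div_le_iff₀ hn']
    linarith
  have hsub : {ω | 6144 * ((σ : ℝ) ^ 4 * d * (d + u)) / n <
      frobSq (covMatrix ν - sampleCov fun j => Y j ω)} ⊆
      ⋃ v ∈ T, {ω | n * s ≤ |∑ j, centeredSq ν (fun z => inner ℝ v z) (σ ^ 2) (Y j ω)|} := by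
    intro ω hω
    by_contra hnot
    simp only [Set.mem_iUnion, Set.mem_ofPred_eq, not_exists, not_le] at hnot
    have h := frobSq_le_of_net (isHermitian_covMatrix_sub_sampleCov (ν := ν) fun j => Y j ω) hT hnet
      (b := 4 * (σ : ℝ) ^ 2 * s) fun v hv => by
        rw [dotProduct_covMatrix_sub_sampleCov_mulVec hν hσ hn _ (hT v hv), abs_neg, abs_mul,
          abs_of_nonneg (by positivity), div_mul_eq_mul_div, div_le_iff₀ hn']
        have := mul_le_mul_of_nonneg_left (hnot v hv).le (by positivity : 0 ≤ 4 * (σ : ℝ) ^ 2)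
        linarith
    refine absurd h (not_le.2 (lt_of_eq_of_lt ?_ hω))
    rw [show (d : ℝ) * (2 * (4 * (σ : ℝ) ^ 2 * s)) ^ 2 = 64 * d * (σ : ℝ) ^ 4 * s ^ 2 by ring, hs2]
    ring
  refine (measureReal_mono hsub (measure_ne_top _ _)).trans ((measureReal_biUnion_finset_le _ _).trans ?_)
  have h5 : (5 : ℝ) ^ d ≤ Real.exp (2 * d) := by
    have h : (5 : ℝ) ≤ Real.exp 2 := by
      have := Real.quadratic_le_exp_of_nonneg (zero_le_two : (0 : ℝ) ≤ 2)
      linarith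
    calc (5 : ℝ) ^ d ≤ Real.exp 2 ^ d := pow_le_pow_left₀ (by norm_num) h d
      _ = _ := by rw [← Real.exp_nat_mul]; ring_nf
  calc _ ≤ ∑ _v ∈ T, 2 * Real.exp (-(n * s ^ 2 / 48)) := Finset.sum_le_sum fun v hv =>
        measureReal_abs_sum_centeredSq_ge_le hY hind (hν v (hT v hv)) (by fun_prop)
          (pow_pos hσ 2) hs0 hs12
    _ = T.card * (2 * Real.exp (-(n * s ^ 2 / 48))) := by rw [Finset.sum_const, nsmul_eq_mul]
    _ ≤ Real.exp (2 * d) * (2 * Real.exp (-(n * s ^ 2 / 48))) := by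
        refine mul_le_mul_of_nonneg_right (le_trans ?_ h5) (by positivity)
        exact_mod_cast hcard
    _ = 2 * Real.exp (-(2 * u)) := by
        rw [mul_left_comm, ← Real.exp_add, hs2]
        congr 2
        field_simp
        ring
    _ ≤ 2 * Real.exp (-u) := by gcongr; linarith

/-- The failure set, which quantifies over all maximizers, is not known to be measurable; its
measurable hull has the same measure. -/
theorem holdsWithProb_of_measureReal_le [IsProbabilityMeasure P] {A : Ω → Prop} {q : ℝ}
    (h : P.real {ω | ¬ A ω} ≤ q) : HoldsWithProb P (1 - q) A := by
  refine ⟨(toMeasurable P {ω | ¬ A ω})ᶜ, (measurableSet_toMeasurable _ _).compl, ?_, fun ω hω => ?_⟩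
  · rw [probReal_compl_eq_one_sub (measurableSet_toMeasurable _ _), measureReal_def,
      measure_toMeasurable, ← measureReal_def]
    linarith
  · by_contra hA
    exact hω (subset_toMeasurable P _ hA)

theorem eigengap_le_two_mul_sq [IsProbabilityMeasure ν] (hν : IsSubGaussian σ ν) {r₁ r₂ : ℕ}
    {Sg Sl Pg Pl : Matrix (Fin d) (Fin d) ℝ}
    (hdec : CovarianceDecomposition r₁ r₂ (covMatrix ν) Sg Sl Pg Pl) (h1 : 1 ≤ r₁)
    (h2 : 1 ≤ r₂) {δ : ℝ} (hgap : δ ≤ min (eig Sg r₁) (eig Sl r₂) -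
      max (eig Sg (r₁ + 1)) (eig Sl (r₂ + 1))) : δ ≤ 2 * (σ : ℝ) ^ 2 := by
  obtain ⟨v, hv, hle⟩ := hdec.exists_le_dotProduct_mulVec h1 h2 hgap
  have hv' : ‖WithLp.toLp 2 v‖ = 1 := by
    have h := dotProduct_self_eq_norm_sq (WithLp.toLp 2 v)
    rw [hv] at h
    exact (pow_eq_one_iff_of_nonneg (norm_nonneg _) two_ne_zero).1 h.symm
  have h3 := dotProduct_covMatrix_mulVec hν hv'
  have h4 := integral_sq_le (hν _ hv') (by fun_prop)
  rw [← h3, NNReal.coe_pow] at h4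
  exact hle.trans h4

end Concentration

/-! ### Union bound over clients and the two sample sizes. -/

section SampleComplexity

variable {d N r₁ : ℕ} {r₂ n : Fin N → ℕ} {σ : ℝ≥0} {θ δ ε : ℝ} {Ω : Type*} [MeasurableSpace Ω]
  {P : Measure Ω} [IsProbabilityMeasure P] {ν : Fin N → Measure (EuclideanSpace ℝ (Fin d))}
  [∀ i, IsProbabilityMeasure (ν i)] {Y : (i : Fin N) → Fin (n i) → Ω → EuclideanSpace ℝ (Fin d)}
  {Sg Sl : Fin N → Matrix (Fin d) (Fin d) ℝ} {Pg : Matrix (Fin d) (Fin d) ℝ}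
  {Pl : Fin N → Matrix (Fin d) (Fin d) ℝ}

theorem holdsWithProb_subspaceError_lt (hN : 0 < N) (h1 : 1 ≤ r₁) (h2 : ∀ i, 1 ≤ r₂ i)
    (hθ : 0 < θ) (hθ1 : θ < 1) (hδ : 0 < δ) (hε : 0 < ε) (hν : ∀ i, IsSubGaussian σ (ν i))
    (hY : ∀ i j, HasLaw (Y i j) (ν i) P) (hind : ∀ i, iIndepFun (Y i) P)
    (hdec : ∀ i, CovarianceDecomposition r₁ (r₂ i) (covMatrix (ν i)) (Sg i) (Sl i) Pg (Pl i))
    (hid : eig ((1 / (N : ℝ)) • ∑ i, Pl i) 1 ≤ 1 - θ)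
    (hgap : ∀ i, δ ≤ min (eig (Sg i) r₁) (eig (Sl i) (r₂ i)) -
      max (eig (Sg i) (r₁ + 1)) (eig (Sl i) (r₂ i + 1)))
    {u : ℝ} (hu : 0 ≤ u)
    (hn : ∀ i, 500000 * ((σ : ℝ) ^ 4 * d * (d + u) / (ε * θ * δ ^ 2)) ≤ n i) :
    HoldsWithProb P (1 - 2 * N * Real.exp (-u)) fun ω =>
      ∀ (U : Matrix (Fin d) (Fin r₁) ℝ) (V : (i : Fin N) → Matrix (Fin d) (Fin (r₂ i)) ℝ),
        IsOptimal (fun i => sampleCov fun j => Y i j ω) U V → subspaceError Pg Pl U V < ε := by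
  refine holdsWithProb_of_measureReal_le ?_
  rcases lt_or_ge (4 * (d : ℝ)) ε with hεd | hεd
  · refine le_trans (le_of_eq ?_) (by positivity : (0 : ℝ) ≤ 2 * N * Real.exp (-u))
    have : {ω | ¬ ∀ (U : Matrix (Fin d) (Fin r₁) ℝ)
        (V : (i : Fin N) → Matrix (Fin d) (Fin (r₂ i)) ℝ),
        IsOptimal (fun i => sampleCov fun j => Y i j ω) U V → subspaceError Pg Pl U V < ε} = ∅ :=
      Set.eq_empty_of_forall_notMem fun ω hω => hω fun U V hUV =>
        (subspaceError_le_four_mul hN hdec hUV.1).trans_lt hεd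
    rw [this, measureReal_empty]
  have hN' : (0 : ℝ) < N := by exact_mod_cast hN
  have hd : (1 : ℝ) ≤ d := by
    have := (hdec ⟨0, hN⟩).add_le
    exact_mod_cast (by omega : 1 ≤ d)
  have hδσ : δ ≤ 2 * (σ : ℝ) ^ 2 :=
    eigengap_le_two_mul_sq (hν ⟨0, hN⟩) (hdec ⟨0, hN⟩) h1 (h2 _) (hgap _)
  have hσ : 0 < σ := by
    rcases eq_or_ne σ 0 with rfl | h
    · simp at hδσ; linarith
    · exact pos_iff_ne_zero.2 h
  have hσ' : (0 : ℝ) < σ := by exact_mod_cast hσ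
  set K : ℝ := (σ : ℝ) ^ 4 * d * (d + u) with hK
  have hK0 : 0 < K := by positivity
  have hden : 0 < ε * θ * δ ^ 2 := by positivity
  have hn0 : ∀ i, (0 : ℝ) < n i := fun i => lt_of_lt_of_le (by positivity) (hn i)
  -- From `ε θ ≤ 4 d` and `δ² ≤ 4 σ⁴`: the sample-size assumption already contains `d + u ≤ n i`,
  -- the regime of the concentration bound.
  have hratio : (d + u) / 16 ≤ K / (ε * θ * δ ^ 2) := by
    have e1 : δ ^ 2 ≤ 4 * (σ : ℝ) ^ 4 := by
      calc δ ^ 2 ≤ (2 * (σ : ℝ) ^ 2) ^ 2 := pow_le_pow_left₀ hδ.le hδσ 2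
        _ = _ := by ring
    have e2 : ε * θ ≤ 4 * d := by nlinarith
    have e3 : ε * θ * δ ^ 2 ≤ 4 * d * (4 * (σ : ℝ) ^ 4) :=
      mul_le_mul e2 e1 (sq_nonneg _) (by positivity)
    rw [le_div_iff₀ hden]
    calc (d + u) / 16 * (ε * θ * δ ^ 2) ≤ (d + u) / 16 * (4 * d * (4 * (σ : ℝ) ^ 4)) := by gcongr
      _ = K := by rw [hK]; ring
  have hun : ∀ i, (d : ℝ) + u ≤ n i := fun i => by linarith [hn i]
  let bad : Fin N → Set Ω := fun i => {ω | 6144 * K / n i <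
    frobSq (covMatrix (ν i) - sampleCov fun j => Y i j ω)}
  have hbad : ∀ i, P.real (bad i) ≤ 2 * Real.exp (-u) := fun i =>
    measureReal_lt_frobSq_le (hν i) hσ (by exact_mod_cast hn0 i) (hY i) (hind i) hu (hun i)
  have hsub : {ω | ¬ ∀ (U : Matrix (Fin d) (Fin r₁) ℝ)
      (V : (i : Fin N) → Matrix (Fin d) (Fin (r₂ i)) ℝ),
      IsOptimal (fun i => sampleCov fun j => Y i j ω) U V → subspaceError Pg Pl U V < ε} ⊆
      ⋃ i, bad i := by
    intro ω hω
    by_contra hnot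
    simp only [bad, Set.mem_iUnion, Set.mem_ofPred_eq, not_exists, not_lt] at hnot
    refine hω fun U V hUV => ?_
    refine (subspaceError_le hN h1 h2 hθ hθ1 hδ hdec hid hgap hUV).trans_lt ?_
    have h3 : ∀ i, frobSq (covMatrix (ν i) - sampleCov fun j => Y i j ω) ≤
        6144 / 500000 * (ε * θ * δ ^ 2) := fun i => by
      refine (hnot i).trans ?_
      rw [div_le_iff₀ (hn0 i)]
      have := mul_le_mul_of_nonneg_left (hn i) hden.le
      have e : ε * θ * δ ^ 2 * (500000 * (K / (ε * θ * δ ^ 2))) = 500000 * K := by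
        field_simp
      rw [e] at this
      linarith
    have h4 : ∑ i, frobSq (covMatrix (ν i) - sampleCov fun j => Y i j ω) ≤
        N * (6144 / 500000 * (ε * θ * δ ^ 2)) := by
      refine (Finset.sum_le_sum fun i _ => h3 i).trans_eq ?_
      simp
    -- The choice of `500000` makes `20 * 6144 / 500000` less than `1`.
    calc _ ≤ 20 / (θ * δ ^ 2) * (1 / (N : ℝ) * (N * (6144 / 500000 * (ε * θ * δ ^ 2)))) := by gcongr
      _ = 20 * (6144 / 500000) * ε := by field_simp
      _ < ε := by linarith
  refine (measureReal_mono hsub (measure_ne_top _ _)).trans ((measureReal_iUnion_fintype_le _).trans ?_)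
  refine (Finset.sum_le_sum fun i _ => hbad i).trans_eq ?_
  rw [Finset.sum_const, Finset.card_univ, Fintype.card_fin, nsmul_eq_mul]
  ring

end SampleComplexity

end PerPCA

theorem corollary2 :
    ∃ C : ℝ, 0 < C ∧
      ∀ (d N r₁ : ℕ) (r₂ n : Fin N → ℕ) (σ : ℝ≥0) (θ δ ε : ℝ)
        (Ω : Type*) [MeasurableSpace Ω] (P : Measure Ω) [IsProbabilityMeasure P]
        (ν : Fin N → Measure (EuclideanSpace ℝ (Fin d))) [∀ i, IsProbabilityMeasure (ν i)]
        (Y : (i : Fin N) → Fin (n i) → Ω → EuclideanSpace ℝ (Fin d))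
        (Sg Sl : Fin N → Matrix (Fin d) (Fin d) ℝ)
        (Pg : Matrix (Fin d) (Fin d) ℝ) (Pl : Fin N → Matrix (Fin d) (Fin d) ℝ),
        0 < N → 1 ≤ r₁ → (∀ i, 1 ≤ r₂ i) → 0 < θ → θ < 1 → 0 < δ → 0 < ε →
        -- i.i.d. sub-Gaussian observations on each client
        (∀ i, PerPCA.IsSubGaussian σ (ν i)) →
        (∀ i j, HasLaw (Y i j) (ν i) P) →
        (∀ i, iIndepFun (Y i) P) →
        -- orthogonality of global and local principal components
        (∀ i, PerPCA.CovarianceDecomposition r₁ (r₂ i) (PerPCA.covMatrix (ν i))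
          (Sg i) (Sl i) Pg (Pl i)) →
        -- identifiability
        PerPCA.eig ((1 / (N : ℝ)) • ∑ i, Pl i) 1 ≤ 1 - θ →
        -- eigengap
        (∀ i, δ ≤ min (PerPCA.eig (Sg i) r₁) (PerPCA.eig (Sl i) (r₂ i)) -
          max (PerPCA.eig (Sg i) (r₁ + 1)) (PerPCA.eig (Sl i) (r₂ i + 1))) →
        -- sample complexity at confidence level `1 - η`
        (∀ η : ℝ, 0 < η → η < 1 →
          (∀ i, C * ((σ : ℝ) ^ 4 * d * (d + Real.log (2 * N / η)) / (ε * θ * δ ^ 2)) ≤ n i) →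
          PerPCA.HoldsWithProb P (1 - η) fun ω =>
            ∀ (U : Matrix (Fin d) (Fin r₁) ℝ) (V : (i : Fin N) → Matrix (Fin d) (Fin (r₂ i)) ℝ),
              PerPCA.IsOptimal (fun i => PerPCA.sampleCov fun j => Y i j ω) U V →
                PerPCA.subspaceError Pg Pl U V < ε) ∧
        -- sample complexity of order `d²`, without logarithmic factor
        ((∀ i, C * ((σ : ℝ) ^ 4 * d ^ 2 / (ε * θ * δ ^ 2)) ≤ n i) →
          PerPCA.HoldsWithProb P (1 - 2 * N * Real.exp (-(d : ℝ))) fun ω =>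
            ∀ (U : Matrix (Fin d) (Fin r₁) ℝ) (V : (i : Fin N) → Matrix (Fin d) (Fin (r₂ i)) ℝ),
              PerPCA.IsOptimal (fun i => PerPCA.sampleCov fun j => Y i j ω) U V →
                PerPCA.subspaceError Pg Pl U V < ε) := by
  -- Twice `500000`, because the second claim takes `u = d`, so that `d + u = 2 d`. The first takes
  -- `u = Real.log (2 * N / η)`, for which `2 N exp (-u) = η`.
  refine ⟨1000000, by norm_num, ?_⟩
  intro d N r₁ r₂ n σ θ δ ε Ω _ P _ ν _ Y Sg Sl Pg Pl hN h1 h2 hθ hθ1 hδ hε hν hY hind hdec hid hgap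
  have hN' : (1 : ℝ) ≤ N := by exact_mod_cast hN
  refine ⟨fun η hη hη1 hn => ?_, fun hn => ?_⟩
  · have hone : 1 ≤ 2 * N / η := by
      rw [le_div_iff₀ hη]; linarith
    have hu := Real.log_nonneg hone
    have h := PerPCA.holdsWithProb_subspaceError_lt hN h1 h2 hθ hθ1 hδ hε hν hY hind hdec hid hgap hu
      fun i => le_trans (mul_le_mul_of_nonneg_right (by norm_num) (by positivity)) (hn i)
    rwa [Real.exp_neg, Real.exp_log (by linarith), inv_div,
      mul_div_cancel₀ _ (by positivity : (2 * N : ℝ) ≠ 0)] at h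
  · refine PerPCA.holdsWithProb_subspaceError_lt hN h1 h2 hθ hθ1 hδ hε hν hY hind hdec hid hgap
      (Nat.cast_nonneg d) fun i => le_trans (le_of_eq ?_) (hn i)
    ring
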